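/- Let $n\ge 4$ be an integer and let $G_n$ be the following finite graph. Take three pairwise disjoint paths $P_i=x^i_1\dots x^i_{2n}$ ($i=0,1,2$) and a path $Q=y_1\dots y_{4n}$ disjoint from them. For all $i\in\{0,1,2\}$, $1\le j\le 2n$ and $1\le k\le 4n$ join $x^i_j$ to $y_k$ by a new path $P^i_{j,k}$, of length $n$ if $k=n+j$ and of length $5n$ otherwise, these paths being internally disjoint from each other and from everything else. Finally add a disjoint cycle $C$ of length $16n+2$, choose two antipodal vertices $a,b$ of $C$ (so $d_C(a,b)=8n+1$), and add the four edges $ax^0_1$, $ay_1$, $bx^0_{2n}$, $by_{4n}$. A vertex set of a graph is connected if it is non-empty and induces a connected subgraph. A tree-decomposition of a graph $G$ is a tree $T$ with vertex sets $V_t\subseteq V(G)$ $(t\in T)$ such that every vertex and every edge of $G$ lies in some $V_t$, and $V_{t_1}\cap V_{t_3}\subseteq V_{t_2}$ whenever $t_2$ lies on the $t_1$–$t_3$ path in $T$; its width is $\max_t(|V_t|-1)$, and it is connected if every $V_t$ is connected in $G$. The connected tree-width $\mathrm{ctw}(G)$ is the minimum width of a connected tree-decomposition of $G$. A bramble of $G$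 is a collection of connected vertex sets of $G$ such that the union of any two of them is connected; its connected order is the minimum size of a connected vertex set that meets all its elements; and $\mathrm{cbn}(G)$ is the maximum connected order of a bramble of $G$. For every $n\ge4$ the graph $G_n$ is finite and connected, $6n\le \mathrm{ctw}(G_n)<\infty$, and every bramble of $G_n$ has connected order at most $5n+3$, that is, it has a connected cover of size at most $5n+3$. Consequently the Diestel–Müller duality conjecture, that $\mathrm{cbn}(G)-1=\mathrm{ctw}(G)$, is false, even for finite connected graphs $G$. -/

import Mathlib

namespace CtwDuality

universe u

/-! ### Connected sets, tree-decompositions, connected tree-width -/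

/-- A vertex set is connected in `G` if it induces a connected (in particular non-empty)
subgraph of `G`. -/
def IsConnectedSet {V : Type u} (G : SimpleGraph V) (X : Set V) : Prop :=
  (G.induce X).Connected

/-- A tree-decomposition of `G`, with nodes of the tree in `ι`. -/
structure TreeDecomposition {V : Type u} (G : SimpleGraph V) (ι : Type u) where
  /-- the decomposition tree -/
  tree : SimpleGraph ι
  isTree : tree.IsTree
  /-- the parts -/
  part : ι → Set V
  vertex_mem : ∀ v : V, ∃ t, v ∈ part t
  edge_mem : ∀ v w : V, G.Adj v w → ∃ t, v ∈ part t ∧ w ∈ part t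
  inter_subset : ∀ (t₁ t₂ t₃ : ι) (p : tree.Walk t₁ t₃), p.IsPath → t₂ ∈ p.support →
    part t₁ ∩ part t₃ ⊆ part t₂

/-- The width of a tree-decomposition: the supremum of the numbers `|V_t| - 1`. -/
noncomputable def TreeDecomposition.width {V : Type u} {G : SimpleGraph V} {ι : Type u}
    (D : TreeDecomposition G ι) : ℕ∞ :=
  ⨆ t, ((D.part t).encard - 1)

/-- A tree-decomposition is connected if all its parts are connected sets of vertices. -/
def TreeDecomposition.IsConnected {V : Type u} {G : SimpleGraph V} {ι : Type u}
    (D : TreeDecomposition G ι) : Prop :=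
  ∀ t, IsConnectedSet G (D.part t)

/-- The connected tree-width of `G`: the minimum width of a connected tree-decomposition
(`⊤` if every connected tree-decomposition has infinite width). -/
noncomputable def connectedTreeWidth {V : Type u} (G : SimpleGraph V) : ℕ∞ :=
  sInf {w | ∃ (ι : Type u) (D : TreeDecomposition G ι), D.IsConnected ∧ D.width = w}

/-! ### Brambles and their connected order -/

/-- A bramble: a collection of connected vertex sets such that the union of any two of them is
again connected. -/
def IsBramble {V : Type u} (G : SimpleGraph V) (B : Set (Set V)) : Prop :=
  (∀ U ∈ B, IsConnectedSet G U) ∧ ∀ U ∈ B, ∀ W ∈ B, IsConnectedSet G (U ∪ W)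

/-- `X` covers `B` if it meets every element of `B`. -/
def IsCover {V : Type u} (B : Set (Set V)) (X : Set V) : Prop :=
  ∀ U ∈ B, (X ∩ U).Nonempty

/-- The connected order of `B`: the minimum size of a connected cover
(`⊤` if there is no finite connected cover). -/
noncomputable def connectedOrder {V : Type u} (G : SimpleGraph V) (B : Set (Set V)) : ℕ∞ :=
  sInf {m | ∃ X : Set V, IsConnectedSet G X ∧ IsCover B X ∧ X.encard = m}

/-- The connected bramble number of `G`: the maximum connected order of a bramble of `G`. -/
noncomputable def connectedBrambleNumber {V : Type u} (G : SimpleGraph V) : ℕ∞ :=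
  sSup {m | ∃ B : Set (Set V), IsBramble G B ∧ connectedOrder G B = m}

/-- The conjectured duality `cbn(G) - 1 = ctw(G)`, for all finite connected graphs. -/
def DualityConjecture : Prop :=
  ∀ (V : Type) [Finite V] (G : SimpleGraph V), G.Connected →
    connectedBrambleNumber G = connectedTreeWidth G + 1

/-! ### The graph

All indices are shifted to start at `0`: the vertex called `x^i_j` in the usual `1`-based
numbering is `x i (j - 1)`, and `y_k` is `y (k - 1)`. -/

/-- The length of the path between `x i j` and `y k`. -/
def linkLength (n : ℕ) (j : Fin (2 * n)) (k : Fin (4 * n)) : ℕ :=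
  if k.val = n + j.val then n else 5 * n

/-- The vertices of the graph. -/
inductive Vertex (n : ℕ) : Type
  /-- the vertices of the three paths `P₀, P₁, P₂` -/
  | x (i : Fin 3) (j : Fin (2 * n)) : Vertex n
  /-- the vertices of the path `Q` -/
  | y (k : Fin (4 * n)) : Vertex n
  /-- the inner vertices of the path joining `x i j` to `y k`, numbered from `x i j` on -/
  | link (i : Fin 3) (j : Fin (2 * n)) (k : Fin (4 * n)) (s : Fin (linkLength n j k - 1)) :
      Vertex n
  /-- the vertices of the cycle `C` of length `16 n + 2`; the antipodal vertices `a` and `b` are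
  number `0` and number `8 n + 1` -/
  | c (m : Fin (16 * n + 2)) : Vertex n

/-- The edges of the graph, each listed in one direction. -/
inductive Step (n : ℕ) : Vertex n → Vertex n → Prop
  | path (i : Fin 3) (j j' : Fin (2 * n)) (h : j'.val = j.val + 1) : Step n (.x i j) (.x i j')
  | pathQ (k k' : Fin (4 * n)) (h : k'.val = k.val + 1) : Step n (.y k) (.y k')
  | linkFirst (i : Fin 3) (j : Fin (2 * n)) (k : Fin (4 * n)) (s : Fin (linkLength n j k - 1))
      (h : s.val = 0) : Step n (.x i j) (.link i j k s)
  | linkInner (i : Fin 3) (j : Fin (2 * n)) (k : Fin (4 * n))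
      (s s' : Fin (linkLength n j k - 1)) (h : s'.val = s.val + 1) :
      Step n (.link i j k s) (.link i j k s')
  | linkLast (i : Fin 3) (j : Fin (2 * n)) (k : Fin (4 * n)) (s : Fin (linkLength n j k - 1))
      (h : s.val + 2 = linkLength n j k) : Step n (.link i j k s) (.y k)
  | cycle (m m' : Fin (16 * n + 2)) (h : m'.val = (m.val + 1) % (16 * n + 2)) :
      Step n (.c m) (.c m')
  | aFirstX (m : Fin (16 * n + 2)) (j : Fin (2 * n)) (hm : m.val = 0) (hj : j.val = 0) :
      Step n (.c m) (.x 0 j)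
  | aFirstY (m : Fin (16 * n + 2)) (k : Fin (4 * n)) (hm : m.val = 0) (hk : k.val = 0) :
      Step n (.c m) (.y k)
  | bLastX (m : Fin (16 * n + 2)) (j : Fin (2 * n)) (hm : m.val = 8 * n + 1)
      (hj : j.val + 1 = 2 * n) : Step n (.c m) (.x 0 j)
  | bLastY (m : Fin (16 * n + 2)) (k : Fin (4 * n)) (hm : m.val = 8 * n + 1)
      (hk : k.val + 1 = 4 * n) : Step n (.c m) (.y k)

/-- The graph with parameter `n`: two vertices are adjacent if they are joined by a step in one
of the two directions. -/
def graph (n : ℕ) : SimpleGraph (Vertex n) :=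
  SimpleGraph.fromRel (Step n)

end CtwDuality

/-! Lower bound. Suppose that a connected tree-decomposition has only parts of at most `6 * n`
vertices. Each node `t` picks a neighbour `f t`. If the part contains `P₀`, it cannot contain all of
`Q`, since `P₀ ∪ Q` has `6 * n` vertices and is disconnected; `t` then points towards a missing
vertex of `Q`. If the part misses a vertex of `P₀`, the graph without that vertex retracts onto a
cycle of length `12 * n + 2`; the image of the part is connected and misses more than half of the
cycle, and `t` points towards the missed vertices (`exists_toward_cycleAt`). Two adjacent nodes
point at each other (`exists_pointing_at_each_other`). Two majorities of the cycle intersect, so not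
both nodes are of the second kind. If both are of the first kind, their adhesion set meets the `6 *
n` disjoint stars formed by the `x i j` and their links, so the two parts coincide, which is absurd
(`not_toward_each_other`). The mixed case is excluded by `contains_of_toward`. Upper bound. Suppose
that no connected set of at most `5 * n + 3` vertices covers the bramble. Some element avoids `Q ∪
{a, b}` and so lies in an arc of `C` or in one `P_i` with its links. An arc is exhausted by two
small connected sets (`IsBramble.not_subset_arc`). On `P_i`, attaching the short link at `x i j` to
`Q ∪ {a, b}` gives a connected set of size `5 * n + 2`; an element it misses lies to the left or to
the right of `x i j`. Where the side changes between consecutive `j`, one further vertex yields a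
cover (`IsBramble.not_subset_segment`). -/

namespace CtwDuality
universe u

/-! ### Directions in a tree -/

section Tree

variable {ι : Type u} {T : SimpleGraph ι}

/-- The node `s` lies on the side of `t'` with respect to the edge `t t'`: it can be reached from
`t'` without passing through `t`. -/
def Beyond (T : SimpleGraph ι) (t t' s : ι) : Prop :=
  ∃ p : T.Walk t' s, p.IsPath ∧ t ∉ p.support

theorem Beyond.of_walk {t t' s : ι} (p : T.Walk t' s) (h : t ∉ p.support) : Beyond T t t' s := by
  classical
  exact ⟨p.bypass, p.bypass_isPath, fun h' => h (p.support_bypass_subset_support h')⟩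

theorem not_beyond_self {t t' : ι} : ¬ Beyond T t t' t := by
  rintro ⟨p, -, h⟩
  exact h p.end_mem_support

theorem beyond_end {t t' : ι} (h : T.Adj t t') : Beyond T t t' t' :=
  Beyond.of_walk .nil (by simpa using h.ne)

theorem Beyond.trans {t t' s s' : ι} (h : Beyond T t t' s) (p : T.Walk s s')
    (hp : t ∉ p.support) : Beyond T t t' s' := by
  obtain ⟨q, -, hq⟩ := h
  refine Beyond.of_walk (q.append p) ?_
  rw [SimpleGraph.Walk.mem_support_append_iff]
  tauto

theorem path_eq (hT : T.IsTree) {s s' : ι} {p q : T.Walk s s'} (hp : p.IsPath) (hq : q.IsPath) :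
    p = q :=
  (hT.existsUnique_path s s').unique hp hq

theorem Beyond.unique (hT : T.IsTree) {t t₁ t₂ s : ι} (h₁ : T.Adj t t₁) (h₂ : T.Adj t t₂)
    (b₁ : Beyond T t t₁ s) (b₂ : Beyond T t t₂ s) : t₁ = t₂ := by
  obtain ⟨p, hp, hpt⟩ := b₁
  obtain ⟨q, hq, hqt⟩ := b₂
  have := path_eq hT (p := .cons h₁ p) (q := .cons h₂ q) (hp.cons hpt) (hq.cons hqt)
  simpa using congrArg SimpleGraph.Walk.snd this

theorem exists_beyond (hT : T.IsTree) {t s : ι} (h : t ≠ s) :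
    ∃ t', T.Adj t t' ∧ Beyond T t t' s := by
  obtain ⟨p, hp, -⟩ := hT.existsUnique_path t s
  cases p with
  | nil => exact absurd rfl h
  | cons hadj q =>
    rw [SimpleGraph.Walk.cons_isPath_iff] at hp
    exact ⟨_, hadj, q, hp.1, hp.2⟩

theorem beyond_or_beyond (hT : T.IsTree) {t t' : ι} (h : T.Adj t t') (s : ι) :
    Beyond T t t' s ∨ Beyond T t' t s := by
  classical
  obtain ⟨p, hp, -⟩ := hT.existsUnique_path t s
  by_cases ht : t' ∈ p.support
  · left
    cases p with
    | nil => exact absurd (by simpa using ht) h.ne'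
    | cons hadj q =>
      rw [SimpleGraph.Walk.cons_isPath_iff] at hp
      have ht' : t' ∈ q.support := by
        simpa [h.ne'] using ht
      exact Beyond.of_walk (q.dropUntil t' ht')
        fun h' => hp.2 (q.support_dropUntil_subset_support ht' h')
  · exact Or.inr ⟨p, hp, ht⟩

theorem not_beyond_of_beyond (hT : T.IsTree) {t t' s : ι} (h : T.Adj t t')
    (b : Beyond T t t' s) : ¬ Beyond T t' t s := by
  obtain ⟨p, hp, hpt⟩ := b
  rintro ⟨q, hq, hqt⟩
  rw [path_eq hT (p := q) hq (hp.cons (h := h) hpt)] at hqt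
  exact hqt (by simp)

theorem dist_eq_of_beyond (hT : T.IsTree) {t t' s : ι} (h : T.Adj t t') (b : Beyond T t t' s) :
    T.dist t s = T.dist t' s + 1 := by
  obtain ⟨p, hp, hpt⟩ := b
  obtain ⟨q, hq, hql⟩ := hT.1.exists_path_of_dist t s
  obtain ⟨r, hr, hrl⟩ := hT.1.exists_path_of_dist t' s
  rw [← hql, ← hrl, path_eq hT hr hp, path_eq hT hq (hp.cons (h := h) hpt)]
  simp

theorem Beyond.of_beyond (hT : T.IsTree) {t t' t'' s : ι} (h : T.Adj t t') (h' : T.Adj t' t'')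
    (hne : t'' ≠ t) (b : Beyond T t' t'' s) : Beyond T t t' s :=
  (beyond_or_beyond hT h s).resolve_right fun b' => hne (b.unique hT h' h.symm b')

/-- The path between two nodes on different sides of an edge contains the ends of the edge. -/
theorem mem_support_of_beyond (hT : T.IsTree) {t t' s s' : ι} (h : T.Adj t t')
    (b : Beyond T t t' s) (b' : Beyond T t' t s') (p : T.Walk s s') :
    t ∈ p.support ∧ t' ∈ p.support := by
  constructor
  · by_contra hp
    exact not_beyond_of_beyond hT h (b.trans p hp) b'
  · by_contra hp
    exact not_beyond_of_beyond hT h.symm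
      (b'.trans p.reverse (by simpa [SimpleGraph.Walk.support_reverse] using hp)) b

/-- If finitely many nodes are given and every node of a tree has a neighbour beyond which some
of them lie, then some two adjacent nodes point at each other. -/
theorem exists_pointing_at_each_other (hT : T.IsTree) {α : Type*} [Finite α] (s : α → ι)
    (f : ι → ι) (hadj : ∀ t, T.Adj t (f t)) (hf : ∀ t, ∃ v, Beyond T t (f t) (s v)) :
    ∃ t, f (f t) = t := by
  classical
  have := Fintype.ofFinite α
  by_contra! hne
  -- The potential adds the distances to those given nodes that lie ahead of `t`. A move to `f t`
  -- without turning back brings no new nodes ahead and shortens every remaining distance, so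
  -- infinite descent applies even in an infinite tree.
  let Φ : ι → ℕ := fun t => ∑ v, if Beyond T t (f t) (s v) then T.dist t (s v) else 0
  have key : ∀ t, Φ (f t) < Φ t := by
    intro t
    have hle : ∀ v, (if Beyond T (f t) (f (f t)) (s v) then T.dist (f t) (s v) else 0) ≤
        if Beyond T t (f t) (s v) then T.dist t (s v) else 0 := by
      intro v
      split_ifs with h₁ h₂
      · rw [dist_eq_of_beyond hT (hadj t) h₂]; omega
      · exact absurd (h₁.of_beyond hT (hadj t) (hadj _) (hne t)) h₂
      · omega
      · omega
    obtain ⟨v, hv⟩ := hf t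
    refine Finset.sum_lt_sum (fun v _ => hle v) ⟨v, Finset.mem_univ v, ?_⟩
    rw [if_pos hv, dist_eq_of_beyond hT (hadj t) hv]
    split_ifs <;> omega
  obtain ⟨t₀⟩ := hT.1.nonempty
  have hdesc : ∀ k : ℕ, ∀ t, Φ t = k → False := by
    intro k
    induction k using Nat.strong_induction_on with
    | _ k ih => exact fun t ht => ih _ (ht ▸ key t) (f t) rfl
  exact hdesc _ t₀ rfl

end Tree

/-! ### Directions in a tree-decomposition -/

namespace TreeDecomposition

variable {V : Type u} {G : SimpleGraph V} {ι : Type u} (D : TreeDecomposition G ι)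

/-- All nodes whose parts contain `v` lie beyond `t'`, seen from `t`. -/
def Toward (t t' : ι) (v : V) : Prop :=
  ∀ s, v ∈ D.part s → Beyond D.tree t t' s

variable {D} {t t' : ι} {v w : V}

theorem Toward.notMem (h : D.Toward t t' v) : v ∉ D.part t :=
  fun hv => not_beyond_self (h t hv)

/-- The tree path from `s` to `s'` uses both ends of the edge, so a vertex occurring on both sides
lies in the adhesion set. -/
theorem mem_part_of_beyond (h : D.tree.Adj t t') {s s' : ι} (hs : v ∈ D.part s)
    (hs' : v ∈ D.part s') (b : Beyond D.tree t t' s) (b' : Beyond D.tree t' t s') :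
    v ∈ D.part t ∧ v ∈ D.part t' := by
  obtain ⟨p, hp, -⟩ := D.isTree.existsUnique_path s s'
  have hmem := mem_support_of_beyond D.isTree h b b' p
  exact ⟨D.inter_subset _ _ _ p hp hmem.1 ⟨hs, hs'⟩, D.inter_subset _ _ _ p hp hmem.2 ⟨hs, hs'⟩⟩

theorem toward_of_beyond (h : D.tree.Adj t t') {s : ι} (hs : v ∈ D.part s)
    (b : Beyond D.tree t t' s) (hv : ¬ (v ∈ D.part t ∧ v ∈ D.part t')) : D.Toward t t' v :=
  fun s' hs' => (beyond_or_beyond D.isTree h s').resolve_right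
    fun b' => hv (mem_part_of_beyond h hs hs' b b')

theorem exists_toward (hv : v ∉ D.part t) : ∃ t', D.tree.Adj t t' ∧ D.Toward t t' v := by
  obtain ⟨s, hs⟩ := D.vertex_mem v
  obtain ⟨t', hadj, b⟩ := exists_beyond D.isTree (t := t) (s := s) (fun h => hv (h ▸ hs))
  exact ⟨t', hadj, toward_of_beyond hadj hs b fun h => hv h.1⟩

theorem toward_of_mem (h : D.tree.Adj t t') (hv' : v ∈ D.part t') (hv : v ∉ D.part t) :
    D.Toward t t' v :=
  toward_of_beyond h hv' (beyond_end h) fun h => hv h.1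

theorem Toward.not_toward (h : D.tree.Adj t t') (hv : D.Toward t t' v) :
    ¬ D.Toward t' t v := by
  obtain ⟨s, hs⟩ := D.vertex_mem v
  exact fun hv' => not_beyond_of_beyond D.isTree h (hv s hs) (hv' s hs)

/-- Directions propagate along edges of the graph outside an adhesion set. -/
theorem Toward.of_adj (h : D.tree.Adj t t') (hv : D.Toward t t' v) (hvw : G.Adj v w)
    (hw : ¬ (w ∈ D.part t ∧ w ∈ D.part t')) : D.Toward t t' w := by
  obtain ⟨s, hs, hs'⟩ := D.edge_mem v w hvw
  exact toward_of_beyond h hs' (hv s hs) hw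

/-- A path that avoids the adhesion set cannot change sides; both orders of `a` and `b` are allowed.
-/
theorem Toward.along (h : D.tree.Adj t t') {f : ℕ → V} {l L : ℕ}
    (hf : ∀ m, l ≤ m → m < L → G.Adj (f m) (f (m + 1)))
    (hS : ∀ m, l ≤ m → m ≤ L → ¬ (f m ∈ D.part t ∧ f m ∈ D.part t')) {a b : ℕ} (ha : l ≤ a)
    (ha' : a ≤ L) (hb : l ≤ b) (hb' : b ≤ L) (hv : D.Toward t t' (f a)) :
    D.Toward t t' (f b) := by
  have up : ∀ k, a + k ≤ L → D.Toward t t' (f (a + k)) := by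
    intro k
    induction k with
    | zero => exact fun _ => hv
    | succ k ih =>
      exact fun hk => (ih (by omega)).of_adj h (hf _ (by omega) (by omega)) (hS _ (by omega) hk)
  have down : ∀ k, l + k ≤ a → D.Toward t t' (f (a - k)) := by
    intro k
    induction k with
    | zero => exact fun _ => hv
    | succ k ih =>
      intro hk
      have hadj := hf (a - (k + 1)) (by omega) (by omega)
      rw [show a - (k + 1) + 1 = a - k by omega] at hadj
      exact (ih (by omega)).of_adj h hadj.symm (hS _ (by omega) (by omega))
  rcases le_total a b with hab | hab
  · obtain ⟨k, rfl⟩ := Nat.exists_eq_add_of_le hab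
    exact up k hb'
  · have := down (a - b) (by omega)
    rwa [show a - (a - b) = b by omega] at this

end TreeDecomposition

/-! ### Connected sets -/

section ConnectedSets

variable {V : Type u} {G : SimpleGraph V}

/-- A connected set that meets `R` and cannot leave it along an edge is a subset of `R`. -/
theorem IsConnectedSet.subset_of_closed {S R : Set V} (hS : IsConnectedSet G S)
    (hmeet : ∃ v ∈ S, v ∈ R)
    (hR : ∀ v ∈ S, ∀ w ∈ S, v ∈ R → G.Adj v w → w ∈ R) : S ⊆ R := by
  obtain ⟨v, hvS, hvR⟩ := hmeet
  intro w hw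
  obtain ⟨p⟩ := hS.preconnected ⟨v, hvS⟩ ⟨w, hw⟩
  have : ∀ (a b : S), (G.induce S).Walk a b → a.1 ∈ R → b.1 ∈ R := by
    intro a b q
    induction q with
    | nil => exact id
    | cons h _ ih => exact fun ha => ih (hR _ (Subtype.prop _) _ (Subtype.prop _) ha h)
  exact this _ _ p hvR

theorem IsConnectedSet.nonempty {S : Set V} (hS : IsConnectedSet G S) : S.Nonempty := by
  obtain ⟨v⟩ := SimpleGraph.Connected.nonempty hS
  exact ⟨v.1, v.2⟩

theorem isConnectedSet_singleton (v : V) : IsConnectedSet G {v} := by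
  unfold IsConnectedSet
  rw [SimpleGraph.connected_iff]
  refine ⟨fun a b => ?_, ⟨⟨v, rfl⟩⟩⟩
  rw [Subsingleton.elim a b]

theorem IsConnectedSet.union {S R : Set V} (hS : IsConnectedSet G S) (hR : IsConnectedSet G R)
    {v w : V} (hv : v ∈ S) (hw : w ∈ R) (h : v = w ∨ G.Adj v w) : IsConnectedSet G (S ∪ R) := by
  rcases h with rfl | h
  · exact SimpleGraph.induce_union_connected hS.preconnected hR.preconnected ⟨v, hv, hw⟩
  · have h1 : IsConnectedSet G {v, w} := SimpleGraph.induce_pair_connected_of_adj h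
    have h2 : IsConnectedSet G (S ∪ {v, w}) :=
      SimpleGraph.induce_union_connected hS.preconnected h1.preconnected ⟨v, hv, by simp⟩
    have h3 : IsConnectedSet G ((S ∪ {v, w}) ∪ R) :=
      SimpleGraph.induce_union_connected h2.preconnected hR.preconnected ⟨w, by simp, hw⟩
    convert h3 using 1
    ext z
    simp only [Set.mem_union, Set.mem_insert_iff, Set.mem_singleton_iff]
    constructor
    · tauto
    · rintro ((h | rfl | rfl) | h) <;> tauto

theorem isConnectedSet_image_Icc {f : ℕ → V} {a b : ℕ} (hab : a ≤ b)
    (hf : ∀ m, a ≤ m → m < b → G.Adj (f m) (f (m + 1))) :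
    IsConnectedSet G (f '' Set.Icc a b) := by
  induction b, hab using Nat.le_induction with
  | base => simpa using isConnectedSet_singleton (G := G) (f a)
  | succ b hab ih =>
    have h := (ih fun m hm hm' => hf m hm (by omega)).union (isConnectedSet_singleton (f (b + 1)))
      (v := f b) (w := f (b + 1)) ⟨b, ⟨hab, le_rfl⟩, rfl⟩ rfl (Or.inr (hf b hab (by omega)))
    convert h using 1
    ext z
    simp only [Set.mem_image, Set.mem_Icc, Set.mem_union, Set.mem_singleton_iff]
    constructor
    · rintro ⟨m, ⟨h₁, h₂⟩, rfl⟩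
      rcases Nat.lt_or_ge m (b + 1) with h | h
      · exact Or.inl ⟨m, ⟨h₁, by omega⟩, rfl⟩
      · exact Or.inr (by rw [show m = b + 1 by omega])
    · rintro (⟨m, ⟨h₁, h₂⟩, rfl⟩ | rfl)
      · exact ⟨m, ⟨h₁, by omega⟩, rfl⟩
      · exact ⟨b + 1, ⟨by omega, le_rfl⟩, rfl⟩

theorem encard_image_Icc_le (f : ℕ → V) {a b k : ℕ} (h : b + 1 ≤ a + k) :
    (f '' Set.Icc a b).encard ≤ k := by
  refine (Set.encard_image_le f _).trans ?_
  rw [← Finset.coe_Icc, Set.encard_coe_eq_coe_finsetCard, Nat.card_Icc]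
  exact_mod_cast (by omega)

theorem encard_union_le_of_le {S R : Set V} {k l m : ℕ} (hS : S.encard ≤ k) (hR : R.encard ≤ l)
    (h : k + l ≤ m) : (S ∪ R).encard ≤ m :=
  (Set.encard_union_le S R).trans ((add_le_add hS hR).trans (by exact_mod_cast h))

/-- A set of size at most `k` that contains `k` different vertices consists of these vertices. -/
theorem eq_range_of_encard_le {α : Type*} [Fintype α] {X : Set V} {k : ℕ} (hX : X.encard ≤ k)
    (g : α → V) (hg : Function.Injective g) (hgX : ∀ z, g z ∈ X) (hα : k ≤ Fintype.card α) :
    X = Set.range g := by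
  have hfin : X.Finite := Set.finite_of_encard_le_coe hX
  refine ((hfin.subset (Set.range_subset_iff.2 hgX)).eq_of_subset_of_encard_le
    (Set.range_subset_iff.2 hgX) (hX.trans ?_)).symm
  rw [← Set.image_univ, hg.encard_image, Set.encard_univ, ENat.card_eq_coe_fintype_card]
  exact_mod_cast hα

end ConnectedSets


/-! ### Walking along the paths of the graph -/

section Graph

variable {n : ℕ}

theorem Step.ne {v w : Vertex n} (h : Step n v w) : v ≠ w := by
  cases h with
  | path i j j' h => simp only [ne_eq, Vertex.x.injEq, true_and]; rintro rfl; omega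
  | pathQ k k' h => simp only [ne_eq, Vertex.y.injEq]; rintro rfl; omega
  | linkInner i j k s s' h => intro h'; cases h'; omega
  | cycle m m' h =>
    simp only [ne_eq, Vertex.c.injEq]
    rintro rfl
    have hm := m.isLt
    rcases Nat.lt_or_ge (m.val + 1) (16 * n + 2) with h' | h'
    · rw [Nat.mod_eq_of_lt h'] at h; omega
    · rw [show m.val + 1 = 16 * n + 2 by omega, Nat.mod_self] at h; omega
  | _ => intro h'; cases h'

theorem Step.adj {v w : Vertex n} (h : Step n v w) : (graph n).Adj v w := by
  rw [graph, SimpleGraph.fromRel_adj]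
  exact ⟨h.ne, Or.inl h⟩

theorem step_or_step_of_adj {v w : Vertex n} (h : (graph n).Adj v w) : Step n v w ∨ Step n w v := by
  rw [graph, SimpleGraph.fromRel_adj] at h
  exact h.2

/-- The vertices of the path `P_i`. -/
def xAt (n : ℕ) (i : Fin 3) (j : ℕ) : Vertex n :=
  -- The junk value is a vertex of `C` because `C` is non-empty for every `n`.
  if h : j < 2 * n then .x i ⟨j, h⟩ else .c ⟨0, by omega⟩

/-- The vertices of the path `Q`. -/
def yAt (n : ℕ) (k : ℕ) : Vertex n :=
  if h : k < 4 * n then .y ⟨k, h⟩ else .c ⟨0, by omega⟩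

/-- The vertices of the cycle `C`. -/
def cAt (n : ℕ) (m : ℕ) : Vertex n :=
  .c ⟨m % (16 * n + 2), Nat.mod_lt _ (by omega)⟩

/-- The vertices of the path between `x i j` and `y k`, including its ends. -/
def linkAt (n : ℕ) (i : Fin 3) (j : Fin (2 * n)) (k : Fin (4 * n)) : ℕ → Vertex n
  | 0 => .x i j
  -- Inner vertex `s` has position `s + 1`; all positions from `linkLength n j k` on give `y k`.
  | s + 1 => if h : s < linkLength n j k - 1 then .link i j k ⟨s, h⟩ else .y k

@[simp] theorem xAt_val (i : Fin 3) (j : Fin (2 * n)) : xAt n i j.val = .x i j := by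
  simp [xAt]

@[simp] theorem yAt_val (k : Fin (4 * n)) : yAt n k.val = .y k := by
  simp [yAt]

@[simp] theorem cAt_val (m : Fin (16 * n + 2)) : cAt n m.val = .c m := by
  simp [cAt, Nat.mod_eq_of_lt m.isLt]

theorem xAt_of_lt (i : Fin 3) {j : ℕ} (h : j < 2 * n) : xAt n i j = .x i ⟨j, h⟩ := by
  simp [xAt, h]

theorem yAt_of_lt {k : ℕ} (h : k < 4 * n) : yAt n k = .y ⟨k, h⟩ := by
  simp [yAt, h]

theorem cAt_of_lt {m : ℕ} (h : m < 16 * n + 2) : cAt n m = .c ⟨m, h⟩ := by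
  simp [cAt, Nat.mod_eq_of_lt h]

theorem xAt_adj (i : Fin 3) {j : ℕ} (h : j + 1 < 2 * n) :
    (graph n).Adj (xAt n i j) (xAt n i (j + 1)) := by
  rw [xAt_of_lt i (by omega), xAt_of_lt i h]
  exact (Step.path i _ _ rfl).adj

theorem yAt_adj {k : ℕ} (h : k + 1 < 4 * n) : (graph n).Adj (yAt n k) (yAt n (k + 1)) := by
  rw [yAt_of_lt (by omega), yAt_of_lt h]
  exact (Step.pathQ _ _ rfl).adj

theorem cAt_adj (m : ℕ) : (graph n).Adj (cAt n m) (cAt n (m + 1)) :=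
  (Step.cycle _ _ (by simp)).adj

theorem le_linkLength (j : Fin (2 * n)) (k : Fin (4 * n)) : n ≤ linkLength n j k := by
  unfold linkLength; split_ifs <;> omega

theorem linkLength_le (j : Fin (2 * n)) (k : Fin (4 * n)) : linkLength n j k ≤ 5 * n := by
  unfold linkLength; split_ifs <;> omega

theorem pos_of_fin (j : Fin (2 * n)) : 0 < n := by
  have := j.isLt
  omega

@[simp] theorem linkAt_zero (i : Fin 3) (j : Fin (2 * n)) (k : Fin (4 * n)) :
    linkAt n i j k 0 = .x i j := rfl

theorem linkAt_succ (i : Fin 3) (j : Fin (2 * n)) (k : Fin (4 * n)) {s : ℕ}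
    (h : s < linkLength n j k - 1) : linkAt n i j k (s + 1) = .link i j k ⟨s, h⟩ := by
  simp [linkAt, h]

@[simp] theorem linkAt_linkLength (i : Fin 3) (j : Fin (2 * n)) (k : Fin (4 * n)) :
    linkAt n i j k (linkLength n j k) = .y k := by
  obtain ⟨s, hs⟩ : ∃ s, linkLength n j k = s + 1 :=
    Nat.exists_eq_succ_of_ne_zero (by have := le_linkLength j k; have := pos_of_fin j; omega)
  rw [hs, linkAt, dif_neg (by omega)]

theorem linkAt_adj (hn : 2 ≤ n) (i : Fin 3) (j : Fin (2 * n)) (k : Fin (4 * n)) {s : ℕ}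
    (h : s < linkLength n j k) : (graph n).Adj (linkAt n i j k s) (linkAt n i j k (s + 1)) := by
  have hl := le_linkLength j k
  rcases s with _ | s
  · rw [linkAt_succ i j k (s := 0) (by omega)]
    exact (Step.linkFirst i j k _ rfl).adj
  · rcases Nat.lt_or_ge (s + 1) (linkLength n j k - 1) with h' | h'
    · rw [linkAt_succ i j k (by omega), linkAt_succ i j k h']
      exact (Step.linkInner i j k _ _ rfl).adj
    · rw [linkAt_succ i j k (by omega), show s + 1 + 1 = linkLength n j k by omega,
        linkAt_linkLength]
      exact (Step.linkLast i j k _ (by simp; omega)).adj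

theorem linkAt_cases (i : Fin 3) (j : Fin (2 * n)) (k : Fin (4 * n)) (m : ℕ) :
    linkAt n i j k m = .x i j ∨ linkAt n i j k m = .y k ∨
      ∃ s, linkAt n i j k m = .link i j k s := by
  rcases m with _ | m
  · exact Or.inl rfl
  · rw [linkAt]
    split_ifs with h
    · exact Or.inr (Or.inr ⟨_, rfl⟩)
    · exact Or.inr (Or.inl rfl)

/-- A connected set that avoids `X` and meets a region whose boundary lies in `X` is contained in
the region. -/
theorem IsConnectedSet.subset_region {S R X : Set (Vertex n)} (hS : IsConnectedSet (graph n) S)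
    (hmeet : ∃ v ∈ S, v ∈ R) (hX : ∀ v ∈ S, v ∉ X)
    (hR : ∀ v w, Step n v w → (v ∈ R → w ∈ R ∨ w ∈ X) ∧ (w ∈ R → v ∈ R ∨ v ∈ X)) : S ⊆ R := by
  refine hS.subset_of_closed hmeet fun v hv w hw hvR hadj => ?_
  rcases step_or_step_of_adj hadj with h | h
  · exact ((hR v w h).1 hvR).resolve_right (hX w hw)
  · exact ((hR w v h).2 hvR).resolve_right (hX w hw)

/-- The inner vertices of the path between `x i j` and `y k`. -/
def linkInterior (i : Fin 3) (j : Fin (2 * n)) (k : Fin (4 * n)) : Set (Vertex n) :=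
  {v | ∃ s, v = .link i j k s}

theorem linkInterior_boundary (i : Fin 3) (j : Fin (2 * n)) (k : Fin (4 * n)) (v w : Vertex n)
    (h : Step n v w) :
    (v ∈ linkInterior i j k → w ∈ linkInterior i j k ∨ w ∈ ({.x i j, .y k} : Set (Vertex n))) ∧
      (w ∈ linkInterior i j k → v ∈ linkInterior i j k ∨ v ∈ ({.x i j, .y k} : Set (Vertex n))) := by
  constructor
  · rintro ⟨s, rfl⟩
    cases h with
    | linkInner => exact Or.inl ⟨_, rfl⟩
    | linkLast => exact Or.inr (Or.inr rfl)
  · rintro ⟨s, rfl⟩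
    cases h with
    | linkFirst => exact Or.inr (Or.inl rfl)
    | linkInner => exact Or.inl ⟨_, rfl⟩

/-- A connected set that contains no end of a link and is not inside the link avoids it. -/
theorem IsConnectedSet.linkAt_notMem {S : Set (Vertex n)} (hS : IsConnectedSet (graph n) S)
    {i : Fin 3} {j : Fin (2 * n)} {k : Fin (4 * n)} (hx : .x i j ∉ S) (hy : .y k ∉ S)
    (hout : ∃ v ∈ S, v ∉ linkInterior i j k) (m : ℕ) : linkAt n i j k m ∉ S := by
  intro hm
  rcases linkAt_cases i j k m with h | h | ⟨s, h⟩ <;> rw [h] at hm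
  · exact hx hm
  · exact hy hm
  · obtain ⟨v, hv, hv'⟩ := hout
    refine hv' (hS.subset_region (R := linkInterior i j k) ⟨_, hm, s, rfl⟩ (X := {.x i j, .y k}) ?_
      (linkInterior_boundary i j k) hv)
    rintro w hw (rfl | rfl)
    · exact hx hw
    · exact hy hw

/-! ### Finiteness and connectedness of the graph -/

instance : Finite (Vertex n) := by
  let f : Vertex n → (Fin 3 × Fin (2 * n)) ⊕ Fin (4 * n) ⊕
      (Fin 3 × (j : Fin (2 * n)) × (k : Fin (4 * n)) × Fin (linkLength n j k - 1)) ⊕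
        Fin (16 * n + 2)
    | .x i j => .inl (i, j)
    | .y k => .inr (.inl k)
    | .link i j k s => .inr (.inr (.inl (i, ⟨j, k, s⟩)))
    | .c m => .inr (.inr (.inr m))
  refine Finite.of_injective f ?_
  intro v w h
  cases v <;> cases w <;> simp [f] at h
  · simp [h]
  · simp [h]
  · obtain ⟨rfl, rfl, h⟩ := h
    simp at h
    obtain ⟨rfl, h⟩ := h
    simp at h
    rw [h]
  · simp [h]

theorem reachable_along {V : Type u} {G : SimpleGraph V} {f : ℕ → V} {b : ℕ}
    (hf : ∀ m, m < b → G.Adj (f m) (f (m + 1))) {m : ℕ} (hm : m ≤ b) : G.Reachable (f 0) (f m) := by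
  induction m with
  | zero => exact .rfl
  | succ m ih => exact (ih (by omega)).trans (hf m (by omega)).reachable

theorem graph_connected (hn : 2 ≤ n) : (graph n).Connected := by
  have hy : ∀ k, (graph n).Reachable (yAt n 0) (.y k) := by
    intro k
    rw [← yAt_val k]
    exact reachable_along (f := yAt n) (b := 4 * n - 1) (fun m hm => yAt_adj (by omega)) (by omega)
  have hx : ∀ i j, (graph n).Reachable (yAt n 0) (.x i j) := by
    intro i j
    have h := reachable_along (f := linkAt n i j ⟨0, by omega⟩) (b := linkLength n j ⟨0, by omega⟩)
      (fun m hm => linkAt_adj hn i j ⟨0, by omega⟩ hm) le_rfl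
    rw [linkAt_linkLength] at h
    exact (hy _).trans h.symm
  have hr : ∀ v, (graph n).Reachable (yAt n 0) v := by
    intro v
    cases v with
    | x i j => exact hx i j
    | y k => exact hy k
    | link i j k s =>
      refine (hx i j).trans ?_
      rw [← linkAt_succ i j k s.isLt]
      exact reachable_along (f := linkAt n i j k) (fun m hm => linkAt_adj hn i j k hm) (by omega)
    | c m =>
      have h : (graph n).Adj (cAt n 0) (yAt n 0) := by
        rw [cAt_of_lt (by omega), yAt_of_lt (by omega)]
        exact (Step.aFirstY _ _ rfl rfl).adj
      rw [← cAt_val m]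
      exact h.symm.reachable.trans (reachable_along (f := cAt n) (b := m.val) (fun m _ => cAt_adj m) le_rfl)
  rw [SimpleGraph.connected_iff]
  exact ⟨fun v w => (hr v).symm.trans (hr w), ⟨yAt n 0⟩⟩

end Graph


/-! ### Retracting the graph without a vertex of `P₀` onto a cycle -/

section Retraction

variable {n : ℕ}

/-- The position on `Q` to which `x i j` is sent when `x 0 m` has been deleted. -/
def xPos (n m : ℕ) (i : Fin 3) (j : ℕ) : ℕ :=
  -- Position `0` is `a`, so `y k` has position `k + 1`. For `i ≠ 0`, `x i j` goes to the end of its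
  -- short link. The left piece of `P₀` starts next to `a` and the right piece ends next to `b`; on
  -- both, the image of `x 0 j` has distance exactly `n` from the end of its short link.
  if i = 0 then (if j < m then j + 1 else 2 * n + j + 1) else n + j + 1

/-- A map from the graph without `x 0 m` to the cycle of length `12 n + 2` that consists of `a`,
the path `Q`, `b` and the arc of `C` with vertices `8 n, ..., 1`. -/
def cyclePos (n m : ℕ) : Vertex n → ℕ
  | .x i j => xPos n m i j
  | .y k => k + 1
  | .link i j k s =>
    -- The image of a link moves straight towards `y k` and waits there after arriving.
    if xPos n m i j ≤ k.val + 1 then min (xPos n m i j + (s.val + 1)) (k.val + 1)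
    else max (xPos n m i j - (s.val + 1)) (k.val + 1)
  -- The second arc of `C` is folded onto the first.
  | .c l => if l.val = 0 then 0 else if l.val ≤ 8 * n + 1 then 12 * n + 2 - l.val
      else l.val - 4 * n

/-- Edges go to edges or single vertices of the cycle; the last two alternatives are its closing
edge. The two pieces of `P₀` have images far apart, but no edge joins them once `x 0 m` is gone. -/
theorem cyclePos_step {m : ℕ} {hm : m < 2 * n} {v w : Vertex n} (h : Step n v w)
    (hv : v ≠ .x 0 ⟨m, hm⟩) (hw : w ≠ .x 0 ⟨m, hm⟩) :
    (cyclePos n m v ≤ cyclePos n m w + 1 ∧ cyclePos n m w ≤ cyclePos n m v + 1) ∨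
      (cyclePos n m v = 0 ∧ cyclePos n m w = 12 * n + 1) ∨
      (cyclePos n m w = 0 ∧ cyclePos n m v = 12 * n + 1) := by
  cases h with
  | path i j j' h =>
    have h1 : i = 0 → j.val ≠ m := by rintro rfl rfl; exact hv rfl
    have h2 : i = 0 → j'.val ≠ m := by rintro rfl rfl; exact hw rfl
    simp only [cyclePos, xPos]
    split_ifs <;> simp_all <;> omega
  | pathQ k k' h => simp only [cyclePos]; omega
  | linkFirst i j k s h => simp only [cyclePos]; split_ifs <;> omega
  | linkInner i j k s s' h => simp only [cyclePos]; split_ifs <;> omega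
  | linkLast i j k s h =>
    -- Here the link lengths enter: a link must be at least as long as the distance along `Q`
    -- between the images of its ends. That distance is at most `n` for short links and less than `4
    -- * n` for all links.
    have hj := j.isLt
    have hk := k.isLt
    simp only [cyclePos, xPos]
    unfold linkLength at h
    split_ifs at h ⊢ <;> omega
  | cycle l l' h =>
    have hl := l.isLt
    simp only [cyclePos]
    rcases Nat.lt_or_ge (l.val + 1) (16 * n + 2) with h' | h'
    · rw [Nat.mod_eq_of_lt h'] at h
      split_ifs <;> omega
    · rw [show l.val + 1 = 16 * n + 2 by omega, Nat.mod_self] at h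
      split_ifs <;> omega
  | aFirstX l j hl hj =>
    have h2 : j.val ≠ m := by rintro rfl; exact hw rfl
    simp only [cyclePos, xPos, if_pos]
    split_ifs <;> omega
  | aFirstY l k hl hk => simp only [cyclePos]; split_ifs; omega
  | bLastX l j hl hj =>
    have h2 : j.val ≠ m := by rintro rfl; exact hw rfl
    simp only [cyclePos, xPos, if_pos]
    split_ifs <;> omega
  | bLastY l k hl hk => simp only [cyclePos]; split_ifs <;> omega

/-- The vertices of the cycle of length `12 n + 2` in their cyclic order. -/
def cycleAt (n : ℕ) (z : ℕ) : Vertex n :=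
  if z = 0 then cAt n 0 else if z ≤ 4 * n then yAt n (z - 1) else cAt n (12 * n + 2 - z)

theorem cyclePos_cycleAt (m : ℕ) {z : ℕ} (hz : z < 12 * n + 2) :
    cyclePos n m (cycleAt n z) = z := by
  unfold cycleAt
  split_ifs with h h'
  · rw [cAt_of_lt (by omega)]; simp [cyclePos, h]
  · rw [yAt_of_lt (by omega)]; simp only [cyclePos]; omega
  · rw [cAt_of_lt (by omega)]; simp only [cyclePos]; split_ifs <;> omega

theorem cycleAt_adj {z : ℕ} (hn : 0 < n) (hz : z + 1 < 12 * n + 2) :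
    (graph n).Adj (cycleAt n z) (cycleAt n (z + 1)) := by
  have hc : ∀ z, 4 * n < z → z + 1 < 12 * n + 2 →
      (graph n).Adj (cAt n (12 * n + 2 - z)) (cAt n (12 * n + 2 - (z + 1))) := by
    intro z h h'
    have := cAt_adj (n := n) (12 * n + 2 - (z + 1))
    rw [show 12 * n + 2 - (z + 1) + 1 = 12 * n + 2 - z by omega] at this
    exact this.symm
  unfold cycleAt
  rw [if_neg (by omega : z + 1 ≠ 0)]
  split_ifs
  · rw [cAt_of_lt (by omega), yAt_of_lt (by omega)]
    exact (Step.aFirstY _ _ rfl (by simp; omega)).adj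
  · omega
  · have := yAt_adj (n := n) (k := z - 1) (by omega)
    rwa [show z - 1 + 1 = z + 1 - 1 by omega] at this
  · rw [cAt_of_lt (by omega), yAt_of_lt (by omega)]
    exact (Step.bLastY _ _ (by simp; omega) (by simp; omega)).adj.symm
  · omega
  · exact hc z (by omega) hz

theorem cycleAt_adj_last (hn : 0 < n) :
    (graph n).Adj (cycleAt n (12 * n + 1)) (cycleAt n 0) := by
  unfold cycleAt
  rw [if_neg (by omega), if_neg (by omega), if_pos rfl,
    show 12 * n + 2 - (12 * n + 1) = 0 + 1 by omega]
  exact (cAt_adj 0).symm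

/-- Two missed positions cut the cycle into two arcs, and the image of a connected set cannot cross
from one to the other. -/
theorem IsConnectedSet.cyclePos_separated {X : Set (Vertex n)} (hX : IsConnectedSet (graph n) X)
    {m : ℕ} {hm : m < 2 * n} (hmX : .x 0 ⟨m, hm⟩ ∉ X) {c d : ℕ} (hd : d < 12 * n + 2)
    (hc : ∀ v ∈ X, cyclePos n m v ≠ c) (hd' : ∀ v ∈ X, cyclePos n m v ≠ d) :
    (∀ v ∈ X, c < cyclePos n m v ∧ cyclePos n m v < d) ∨
      ∀ v ∈ X, ¬ (c < cyclePos n m v ∧ cyclePos n m v < d) := by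
  by_cases h : ∃ v ∈ X, c < cyclePos n m v ∧ cyclePos n m v < d
  · left
    refine hX.subset_of_closed (R := {v | c < cyclePos n m v ∧ cyclePos n m v < d}) h ?_
    intro v hv w hw hvR hadj
    have hcw := hc w hw
    have hdw := hd' w hw
    have hne : ∀ u ∈ X, u ≠ .x 0 ⟨m, hm⟩ := fun u hu h => hmX (h ▸ hu)
    simp only [Set.mem_ofPred_eq] at hvR ⊢
    rcases step_or_step_of_adj hadj with h | h
    · have := cyclePos_step h (hne v hv) (hne w hw)
      omega
    · have := cyclePos_step h (hne w hw) (hne v hv)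
      omega
  · exact Or.inr fun v hv hv' => h ⟨v, hv, hv'⟩

open TreeDecomposition in
/-- A small part that misses a vertex of `P₀` has more than half of the cycle of length
`12 n + 2` in one direction. -/
theorem exists_toward_cycleAt (hn : 0 < n) {ι : Type} {D : TreeDecomposition (graph n) ι} {t : ι}
    (hconn : IsConnectedSet (graph n) (D.part t)) (hcard : (D.part t).encard ≤ (6 * n : ℕ))
    {m : ℕ} {hm : m < 2 * n} (hmt : .x 0 ⟨m, hm⟩ ∉ D.part t) :
    ∃ t', D.tree.Adj t t' ∧ ∃ Z ⊆ Finset.range (12 * n + 2), 6 * n + 2 ≤ Z.card ∧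
      ∀ z ∈ Z, D.Toward t t' (cycleAt n z) := by
  classical
  have hfin : (D.part t).Finite := Set.toFinite _
  let Y : Finset ℕ := hfin.toFinset.image (cyclePos n m)
  have hY : Y.card ≤ 6 * n := by
    refine Finset.card_image_le.trans ?_
    rw [hfin.encard_eq_coe_toFinset_card] at hcard
    exact_mod_cast hcard
  have hmemY : ∀ v ∈ D.part t, cyclePos n m v ∈ Y := fun v hv =>
    Finset.mem_image_of_mem _ (hfin.mem_toFinset.2 hv)
  have hcount : 6 * n + 2 ≤ (Finset.range (12 * n + 2) \ Y).card := by
    have := Finset.le_card_sdiff Y (Finset.range (12 * n + 2))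
    rw [Finset.card_range] at this
    omega
  obtain ⟨z₀, hz₀⟩ := Finset.card_pos.1 (by omega : 0 < (Finset.range (12 * n + 2) \ Y).card)
  have hout : ∀ z < 12 * n + 2, (∀ v ∈ D.part t, cyclePos n m v ≠ z) → cycleAt n z ∉ D.part t :=
    fun z hz h hz' => h _ hz' (cyclePos_cycleAt m hz)
  have hZ : ∀ z ∈ Finset.range (12 * n + 2) \ Y,
      z < 12 * n + 2 ∧ ∀ v ∈ D.part t, cyclePos n m v ≠ z := by
    intro z hz
    rw [Finset.mem_sdiff, Finset.mem_range] at hz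
    exact ⟨hz.1, fun v hv h => hz.2 (h ▸ hmemY v hv)⟩
  obtain ⟨t', hadj, ht'⟩ := exists_toward (hout z₀ (hZ z₀ hz₀).1 (hZ z₀ hz₀).2)
  -- One of the two arcs between missed positions `c` and `d` is disjoint from the part: the one
  -- through position `0` if the image of the part lies between them, otherwise the direct one.
  have key : ∀ c d, c ≤ d → d < 12 * n + 2 → (∀ v ∈ D.part t, cyclePos n m v ≠ c) →
      (∀ v ∈ D.part t, cyclePos n m v ≠ d) →
      (D.Toward t t' (cycleAt n c) ↔ D.Toward t t' (cycleAt n d)) := by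
    intro c d hcd hd hcX hdX
    rcases hconn.cyclePos_separated hmt hd hcX hdX with h | h
    · have hup : ∀ a b, d ≤ a → a < 12 * n + 2 → d ≤ b → b < 12 * n + 2 →
          D.Toward t t' (cycleAt n a) → D.Toward t t' (cycleAt n b) := by
        intro a b ha ha' hb hb'
        refine Toward.along hadj (f := cycleAt n) (l := d) (L := 12 * n + 1)
          (fun z _ _ => cycleAt_adj hn (by omega)) (fun z hz hz' h' => ?_) ha (by omega) hb
          (by omega)
        exact hout z (by omega) (fun v hv hvz => by have := h v hv; omega) h'.1
      have hdown : ∀ a b, a ≤ c → b ≤ c →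
          D.Toward t t' (cycleAt n a) → D.Toward t t' (cycleAt n b) := by
        intro a b ha hb
        refine Toward.along hadj (f := cycleAt n) (l := 0) (L := c)
          (fun z _ _ => cycleAt_adj hn (by omega)) (fun z hz hz' h' => ?_) (by omega) ha
          (by omega) hb
        exact hout z (by omega) (fun v hv hvz => by have := h v hv; omega) h'.1
      have h0 : ¬ (cycleAt n 0 ∈ D.part t ∧ cycleAt n 0 ∈ D.part t') := fun h' =>
        hout 0 (by omega) (fun v hv hvz => by have := h v hv; omega) h'.1
      have hl : ¬ (cycleAt n (12 * n + 1) ∈ D.part t ∧ cycleAt n (12 * n + 1) ∈ D.part t') :=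
        fun h' => hout (12 * n + 1) (by omega)
          (fun v hv hvz => by have := h v hv; omega) h'.1
      constructor
      · intro hc
        exact hup _ _ (by omega) (by omega) le_rfl hd
          ((hdown c 0 le_rfl (by omega) hc).of_adj hadj (cycleAt_adj_last hn).symm hl)
      · intro hd'
        exact hdown 0 _ (by omega) le_rfl
          ((hup d (12 * n + 1) le_rfl hd (by omega) (by omega) hd').of_adj hadj
            (cycleAt_adj_last hn) h0)
    · have hS : ∀ z, c ≤ z → z ≤ d →
          ¬ (cycleAt n z ∈ D.part t ∧ cycleAt n z ∈ D.part t') := by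
        intro z hz hz' h'
        refine hout z (by omega) (fun v hv hvz => ?_) h'.1
        have := h v hv
        have := hcX v hv
        have := hdX v hv
        omega
      have hA : ∀ z, c ≤ z → z < d → (graph n).Adj (cycleAt n z) (cycleAt n (z + 1)) :=
        fun z _ _ => cycleAt_adj hn (by omega)
      exact ⟨Toward.along hadj hA hS le_rfl hcd hcd le_rfl,
        Toward.along hadj hA hS hcd le_rfl le_rfl hcd⟩
  refine ⟨t', hadj, _, Finset.sdiff_subset, hcount, fun z hz => ?_⟩
  rcases le_total z₀ z with h | h
  · exact (key z₀ z h (hZ z hz).1 (hZ z₀ hz₀).2 (hZ z hz).2).1 ht'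
  · exact (key z z₀ h (hZ z₀ hz₀).1 (hZ z hz).2 (hZ z₀ hz₀).2).2 ht'

end Retraction


/-! ### The lower bound on the connected tree-width -/

section LowerBound

open TreeDecomposition

variable {n : ℕ} {ι : Type} {D : TreeDecomposition (graph n) ι} {t t' : ι}

/-- A link that joins vertices on different sides of an edge of the decomposition tree meets the
adhesion set. -/
theorem exists_link_mem (hn : 2 ≤ n) (hadj : D.tree.Adj t t') {i : Fin 3} {j : Fin (2 * n)}
    {k : Fin (4 * n)} (hy : D.Toward t t' (.y k)) (hx : D.Toward t' t (.x i j)) :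
    ∃ s, .link i j k s ∈ D.part t ∧ .link i j k s ∈ D.part t' := by
  by_contra! h
  refine hx.not_toward hadj.symm ?_
  have := Toward.along hadj (f := linkAt n i j k) (l := 0) (L := linkLength n j k)
    (a := linkLength n j k) (b := 0) (fun m _ hm => linkAt_adj hn i j k hm) ?_ (by omega) le_rfl
    le_rfl (by omega) (by rwa [linkAt_linkLength])
  · simpa using this
  · intro m _ _
    rcases linkAt_cases i j k m with h' | h' | ⟨s, h'⟩ <;> rw [h']
    · exact fun h => hx.notMem h.2
    · exact fun h => hy.notMem h.1
    · exact fun hs => h s hs.1 hs.2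

/-- The ends of a link outside a part lie in the same direction, if the part is not inside the
link. -/
theorem Toward.link_iff (hn : 2 ≤ n) (hadj : D.tree.Adj t t')
    (hconn : IsConnectedSet (graph n) (D.part t)) {i : Fin 3} {j : Fin (2 * n)}
    {k : Fin (4 * n)} (hx : .x i j ∉ D.part t) (hy : .y k ∉ D.part t)
    (hout : ∃ v ∈ D.part t, v ∉ linkInterior i j k) :
    D.Toward t t' (.x i j) ↔ D.Toward t t' (.y k) := by
  have hA : ∀ m, 0 ≤ m → m < linkLength n j k →
      (graph n).Adj (linkAt n i j k m) (linkAt n i j k (m + 1)) :=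
    fun m _ hm => linkAt_adj hn i j k hm
  have hS : ∀ m, 0 ≤ m → m ≤ linkLength n j k →
      ¬ (linkAt n i j k m ∈ D.part t ∧ linkAt n i j k m ∈ D.part t') :=
    fun m _ _ h => hconn.linkAt_notMem hx hy hout m h.1
  rw [← linkAt_linkLength i j k, ← linkAt_zero i j k]
  exact ⟨Toward.along hadj hA hS le_rfl (by omega) (by omega) le_rfl,
    Toward.along hadj hA hS (by omega) le_rfl le_rfl (by omega)⟩

theorem not_adj_x_y {i : Fin 3} {j : Fin (2 * n)} {k : Fin (4 * n)} :
    ¬ (graph n).Adj (.x i j) (.y k) := by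
  intro h
  rcases step_or_step_of_adj h with h | h <;> cases h

/-- A small connected set misses a vertex of one of the paths `P_i`. -/
theorem exists_x_notMem (hn : 0 < n) {X : Set (Vertex n)} (hX : IsConnectedSet (graph n) X)
    (hcard : X.encard ≤ (6 * n : ℕ)) : ∃ i j, .x i j ∉ X := by
  by_contra! h
  have hXeq := eq_range_of_encard_le hcard (fun z : Fin 3 × Fin (2 * n) => Vertex.x z.1 z.2)
    (by rintro ⟨i, j⟩ ⟨i', j'⟩ h; simpa using h) (fun z => h _ _) (by simp; omega)
  -- No edge leads from `P₀` to `P₁` or `P₂`, so a connected set consisting of the three paths would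
  -- lie in `P₀`.
  have hsub : X ⊆ {v | ∃ j, v = .x 0 j} := by
    refine hX.subset_of_closed ⟨_, h 0 ⟨0, by omega⟩, _, rfl⟩ ?_
    rintro v - w hw ⟨j, rfl⟩ hadj
    rw [hXeq] at hw
    obtain ⟨⟨i, j'⟩, rfl⟩ := hw
    rcases step_or_step_of_adj hadj with h | h <;> cases h <;> exact ⟨_, rfl⟩
  obtain ⟨j, hj⟩ := hsub (h 1 ⟨0, by omega⟩)
  cases hj

/-- A small connected set that contains `P₀` misses a vertex of `Q`. -/
theorem exists_y_notMem (hn : 0 < n) {X : Set (Vertex n)} (hX : IsConnectedSet (graph n) X)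
    (hcard : X.encard ≤ (6 * n : ℕ)) (hP : ∀ j, .x 0 j ∈ X) : ∃ k, .y k ∉ X := by
  by_contra! h
  have hXeq := eq_range_of_encard_le hcard
    (Sum.elim (fun j : Fin (2 * n) => Vertex.x 0 j) (fun k : Fin (4 * n) => Vertex.y k))
    (by rintro (j | k) (j' | k') h <;> cases h <;> rfl) (by rintro (j | k); exacts [hP _, h _])
    (by simp; omega)
  have hsub : X ⊆ {v | ∃ j, v = .x 0 j} := by
    refine hX.subset_of_closed ⟨_, hP ⟨0, by omega⟩, _, rfl⟩ ?_
    rintro v - w hw ⟨j, rfl⟩ hadj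
    rw [hXeq] at hw
    obtain ⟨j' | k', rfl⟩ := hw
    · exact ⟨_, rfl⟩
    · exact absurd hadj not_adj_x_y
  obtain ⟨j, hj⟩ := hsub (h ⟨0, by omega⟩)
  cases hj

/-- Two adjacent parts cannot both see vertices of `Q` and all the remaining vertices of the paths
`P_i` in the direction of the other part. -/
theorem not_toward_each_other (hn : 2 ≤ n) (hadj : D.tree.Adj t t')
    (hconn : IsConnectedSet (graph n) (D.part t)) (hcard : (D.part t).encard ≤ (6 * n : ℕ))
    (hcard' : (D.part t').encard ≤ (6 * n : ℕ)) {k k' : Fin (4 * n)}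
    (hy : D.Toward t t' (.y k)) (hy' : D.Toward t' t (.y k'))
    (hx : ∀ i j, .x i j ∉ D.part t → D.Toward t t' (.x i j))
    (hx' : ∀ i j, .x i j ∉ D.part t' → D.Toward t' t (.x i j)) : False := by
  have hstar : ∀ z : Fin 3 × Fin (2 * n), ∃ v,
      (v = .x z.1 z.2 ∨ ∃ k s, v = .link z.1 z.2 k s) ∧ v ∈ D.part t ∧ v ∈ D.part t' := by
    rintro ⟨i, j⟩
    by_cases h : .x i j ∈ D.part t
    · by_cases h' : .x i j ∈ D.part t'
      · exact ⟨_, Or.inl rfl, h, h'⟩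
      · obtain ⟨s, hs⟩ := exists_link_mem hn hadj hy (hx' i j h')
        exact ⟨_, Or.inr ⟨_, _, rfl⟩, hs⟩
    · obtain ⟨s, hs⟩ := exists_link_mem hn hadj.symm hy' (hx i j h)
      exact ⟨_, Or.inr ⟨_, _, rfl⟩, hs.symm⟩
  choose g hg hgt hgt' using hstar
  have hinj : Function.Injective g := by
    rintro ⟨i, j⟩ ⟨i', j'⟩ h
    have h1 := hg (i, j)
    have h2 := hg (i', j')
    rw [h] at h1
    rcases h1 with h1 | ⟨k, s, h1⟩ <;> rcases h2 with h2 | ⟨k', s', h2⟩ <;>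
      rw [h1] at h2 <;> cases h2 <;> rfl
  have hcd : 6 * n ≤ Fintype.card (Fin 3 × Fin (2 * n)) := by simp; omega
  -- The `6 * n` chosen vertices lie in disjoint stars and in both parts, so they fill both.
  have heq : D.part t = D.part t' :=
    (eq_range_of_encard_le hcard g hinj hgt hcd).trans
      (eq_range_of_encard_le hcard' g hinj hgt' hcd).symm
  obtain ⟨i, j, hij⟩ := exists_x_notMem (by omega) hconn hcard
  exact (hx i j hij).not_toward hadj (hx' i j (heq ▸ hij))

/-- If one of two small adjacent parts contains `P₀` and the other one does not, then the other one
does not contain `Q`. -/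
theorem exists_y_notMem_of_adj (hn : 2 ≤ n) (hadj : D.tree.Adj t t')
    (hconn : IsConnectedSet (graph n) (D.part t)) (hcard : (D.part t).encard ≤ (6 * n : ℕ))
    (hconn' : IsConnectedSet (graph n) (D.part t')) (hcard' : (D.part t').encard ≤ (6 * n : ℕ))
    (hP : ∀ j, .x 0 j ∈ D.part t) {j₀ : Fin (2 * n)} (hj₀ : .x 0 j₀ ∉ D.part t') :
    ∃ k, .y k ∉ D.part t' := by
  by_contra! hQ
  obtain ⟨k₀, hk₀⟩ := exists_y_notMem (by omega) hconn hcard hP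
  have hlink : ∀ j k, .x 0 j ∉ D.part t' → .y k ∉ D.part t →
      ∃ s, .link 0 j k s ∈ D.part t ∧ .link 0 j k s ∈ D.part t' := fun j k hj hk =>
    exists_link_mem hn hadj (toward_of_mem hadj (hQ k) hk) (toward_of_mem hadj.symm (hP j) hj)
  have hg : ∀ j, ∃ v, (v = .x 0 j ∨ (.x 0 j ∉ D.part t' ∧ ∃ s, v = .link 0 j k₀ s)) ∧
      v ∈ D.part t' := by
    intro j
    by_cases h : .x 0 j ∈ D.part t'
    · exact ⟨_, Or.inl rfl, h⟩
    · obtain ⟨s, hs⟩ := hlink j k₀ h hk₀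
      exact ⟨_, Or.inr ⟨h, s, rfl⟩, hs.2⟩
  have hh : ∀ k, ∃ v, (v = .y k ∨ ∃ s, v = .link 0 j₀ k s) ∧ v ∈ D.part t := by
    intro k
    by_cases h : .y k ∈ D.part t
    · exact ⟨_, Or.inl rfl, h⟩
    · obtain ⟨s, hs⟩ := hlink j₀ k hj₀ h
      exact ⟨_, Or.inr ⟨s, rfl⟩, hs.1⟩
  choose g hg hgt using hg
  choose h hh hht using hh
  -- Counting determines both parts: `t` consists of `P₀` and one vertex for each `k`, and `t'` of
  -- `Q` and one vertex for each `j`.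
  have hX := eq_range_of_encard_le hcard
    (Sum.elim (fun j : Fin (2 * n) => Vertex.x 0 j) h)
    (by
      rintro (j | k) (j' | k') he <;> simp only [Sum.elim_inl, Sum.elim_inr] at he
      · cases he; rfl
      · rcases hh k' with h2 | ⟨s, h2⟩ <;> rw [h2] at he <;> cases he
      · rcases hh k with h2 | ⟨s, h2⟩ <;> rw [h2] at he <;> cases he
      · have h1 := hh k
        rw [he] at h1
        rcases h1 with h1 | ⟨s, h1⟩ <;> rcases hh k' with h2 | ⟨s', h2⟩ <;>
          rw [h1] at h2 <;> cases h2 <;> rfl)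
    (by rintro (j | k); exacts [hP _, hht _]) (by simp; omega)
  have hX' := eq_range_of_encard_le hcard'
    (Sum.elim (fun k : Fin (4 * n) => Vertex.y k) g)
    (by
      rintro (j | k) (j' | k') he <;> simp only [Sum.elim_inl, Sum.elim_inr] at he
      · cases he; rfl
      · rcases hg k' with h2 | ⟨-, s, h2⟩ <;> rw [h2] at he <;> cases he
      · rcases hg k with h2 | ⟨-, s, h2⟩ <;> rw [h2] at he <;> cases he
      · have h1 := hg k
        rw [he] at h1
        rcases h1 with h1 | ⟨-, s, h1⟩ <;> rcases hg k' with h2 | ⟨-, s', h2⟩ <;>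
          rw [h1] at h2 <;> cases h2 <;> rfl)
    (by rintro (j | k); exacts [hQ _, hgt _]) (by simp; omega)
  -- Otherwise `t` would contain an inner vertex of a link at `x 0 j`, but its inner link vertices
  -- all belong to links at `x 0 j₀`.
  have hother : ∀ j, j ≠ j₀ → .x 0 j ∈ D.part t' := by
    intro j hj
    by_contra hjt
    obtain ⟨s, hs, -⟩ := hlink j k₀ hjt hk₀
    rw [hX] at hs
    obtain ⟨j' | k', he⟩ := hs
    · cases he
    · simp only [Sum.elim_inr] at he
      rcases hh k' with h2 | ⟨s', h2⟩ <;> rw [h2] at he <;> cases he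
      exact hj rfl
  obtain ⟨j₁, hj₁⟩ : ∃ j₁ : Fin (2 * n), j₁ ≠ j₀ := by
    have : Nontrivial (Fin (2 * n)) := Fin.nontrivial_iff_two_le.2 (by omega)
    exact exists_ne j₀
  -- Now `t'` consists of `Q`, `P₀` without `x 0 j₀`, and one inner vertex of a link at `x 0 j₀`; no
  -- edge leaves the `P₀` piece inside this set.
  have hsub : D.part t' ⊆ {v | ∃ j, v = .x 0 j} := by
    refine hconn'.subset_of_closed ⟨_, hother j₁ hj₁, _, rfl⟩ ?_
    rintro v hv w hw ⟨j, rfl⟩ hadj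
    rw [hX'] at hw
    obtain ⟨k' | j', rfl⟩ := hw
    · exact absurd hadj not_adj_x_y
    · simp only [Sum.elim_inr] at hadj ⊢
      rcases hg j' with h2 | ⟨h1, s, h2⟩ <;> rw [h2] at hadj ⊢
      · exact ⟨_, rfl⟩
      · rcases step_or_step_of_adj hadj with h | h <;> cases h
        exact absurd hv h1
  obtain ⟨j, hj⟩ := hsub (hQ k₀)
  cases hj

/-- If a small part contains `P₀`, then so does every small adjacent part in the direction of a
vertex of `Q`. -/
theorem contains_of_toward (hn : 2 ≤ n) (hadj : D.tree.Adj t t')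
    (hconn : IsConnectedSet (graph n) (D.part t)) (hcard : (D.part t).encard ≤ (6 * n : ℕ))
    (hconn' : IsConnectedSet (graph n) (D.part t')) (hcard' : (D.part t').encard ≤ (6 * n : ℕ))
    (hP : ∀ j, .x 0 j ∈ D.part t) {k : Fin (4 * n)} (hk : D.Toward t t' (.y k))
    (j : Fin (2 * n)) : .x 0 j ∈ D.part t' := by
  by_contra hj
  obtain ⟨k', hk'⟩ := exists_y_notMem_of_adj hn hadj hconn hcard hconn' hcard' hP hj
  have hout : ∀ i j k, ∃ v ∈ D.part t', v ∉ linkInterior i j k := by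
    intro i₁ j₁ k₁
    obtain ⟨j₂, hj₂⟩ : ∃ j₂ : Fin (2 * n), j₂ ≠ j₁ := by
      have : Nontrivial (Fin (2 * n)) := Fin.nontrivial_iff_two_le.2 (by omega)
      exact exists_ne j₁
    by_cases h : .x 0 j₂ ∈ D.part t'
    · exact ⟨_, h, by rintro ⟨s, hs⟩; cases hs⟩
    · obtain ⟨s, -, hs⟩ := exists_link_mem hn hadj hk (toward_of_mem hadj.symm (hP j₂) h)
      exact ⟨_, hs, by rintro ⟨s, hs⟩; cases hs; exact hj₂ rfl⟩
  have hy' : D.Toward t' t (.y k') :=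
    (Toward.link_iff hn hadj.symm hconn' hj hk' (hout _ _ _)).1 (toward_of_mem hadj.symm (hP j) hj)
  refine not_toward_each_other hn hadj hconn hcard hcard' hk hy' (fun i₁ j₁ h => ?_)
    (fun i₁ j₁ h => ?_)
  · exact (Toward.link_iff hn hadj hconn h hk.notMem
      ⟨_, hP ⟨0, by omega⟩, by rintro ⟨s, hs⟩; cases hs⟩).2 hk
  · exact (Toward.link_iff hn hadj.symm hconn' h hk' (hout _ _ _)).2 hy'

/-- Every connected tree-decomposition has a part with more than `6 n` vertices. -/
theorem exists_large_part (hn : 2 ≤ n) (D : TreeDecomposition (graph n) ι) (hD : D.IsConnected) :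
    ∃ t, ¬ (D.part t).encard ≤ (6 * n : ℕ) := by
  by_contra! hcard
  let Good : ι → ι → Prop := fun t t' => D.tree.Adj t t' ∧
    (((∀ j, .x 0 j ∈ D.part t) ∧ ∃ k, D.Toward t t' (.y k)) ∨
      ((∃ j, .x 0 j ∉ D.part t) ∧ ∃ Z ⊆ Finset.range (12 * n + 2), 6 * n + 2 ≤ Z.card ∧
        ∀ z ∈ Z, D.Toward t t' (cycleAt n z)))
  have hex : ∀ t, ∃ t', Good t t' := by
    intro t
    by_cases h : ∀ j, .x 0 j ∈ D.part t
    · obtain ⟨k, hk⟩ := exists_y_notMem (by omega) (hD t) (hcard t) h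
      obtain ⟨t', hadj, ht'⟩ := exists_toward hk
      exact ⟨t', hadj, Or.inl ⟨h, k, ht'⟩⟩
    · push Not at h
      obtain ⟨j, hj⟩ := h
      obtain ⟨t', hadj, hZ⟩ := exists_toward_cycleAt (by omega) (hD t) (hcard t) (hm := j.isLt) hj
      exact ⟨t', hadj, Or.inr ⟨⟨j, hj⟩, hZ⟩⟩
  choose f hf using hex
  choose s hs using D.vertex_mem
  obtain ⟨t, ht⟩ := exists_pointing_at_each_other D.isTree s f (fun t => (hf t).1) (by
    intro t
    rcases (hf t).2 with ⟨-, k, hk⟩ | ⟨-, Z, -, hZ, hZt⟩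
    · exact ⟨_, hk _ (hs _)⟩
    · obtain ⟨z, hz⟩ := Finset.card_pos.1 (by omega : 0 < Z.card)
      exact ⟨_, hZt z hz _ (hs _)⟩)
  have h1 := hf t
  have h2 := hf (f t)
  rw [ht] at h2
  obtain ⟨hadj, ⟨hP, k, hk⟩ | ⟨⟨j, hj⟩, Z, hZs, hZ, hZt⟩⟩ := h1 <;>
    obtain ⟨-, ⟨hP', k', hk'⟩ | ⟨⟨j', hj'⟩, Z', hZs', hZ', hZt'⟩⟩ := h2
  · refine not_toward_each_other hn hadj (hD _) (hcard _) (hcard _) hk hk'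
      (fun i₁ j₁ h => ?_) (fun i₁ j₁ h => ?_)
    · exact (Toward.link_iff hn hadj (hD _) h hk.notMem
        ⟨_, hP ⟨0, by omega⟩, by rintro ⟨s, hs⟩; cases hs⟩).2 hk
    · exact (Toward.link_iff hn hadj.symm (hD _) h hk'.notMem
        ⟨_, hP' ⟨0, by omega⟩, by rintro ⟨s, hs⟩; cases hs⟩).2 hk'
  · exact hj' (contains_of_toward hn hadj (hD _) (hcard _) (hD _) (hcard _) hP hk j')
  · exact hj (contains_of_toward hn hadj.symm (hD _) (hcard _) (hD _) (hcard _) hP' hk' j)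
  -- Two sets of at least `6 * n + 2` positions among `12 * n + 2` must intersect.
  · have hinter : (Z ∩ Z').Nonempty := by
      by_contra hne
      have hdisj : Disjoint Z Z' :=
        Finset.disjoint_iff_inter_eq_empty.2 (Finset.not_nonempty_iff_eq_empty.1 hne)
      have h3 := Finset.card_le_card (Finset.union_subset hZs hZs')
      rw [Finset.card_union_of_disjoint hdisj, Finset.card_range] at h3
      omega
    obtain ⟨z, hz⟩ := hinter
    rw [Finset.mem_inter] at hz
    exact (hZt z hz.1).not_toward hadj (hZt' z hz.2)

theorem le_connectedTreeWidth (hn : 2 ≤ n) :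
    ((6 * n : ℕ) : ℕ∞) ≤ connectedTreeWidth (graph n) := by
  refine le_sInf ?_
  rintro w ⟨ι, D, hD, rfl⟩
  obtain ⟨t, ht⟩ := exists_large_part hn D hD
  refine le_trans ?_ (le_iSup _ t)
  rw [(Set.toFinite (D.part t)).encard_eq_coe_toFinset_card] at ht ⊢
  have h : 6 * n < (Set.toFinite (D.part t)).toFinset.card := by
    by_contra h
    exact ht (by exact_mod_cast not_lt.1 h)
  exact_mod_cast (by omega :
    6 * n ≤ (Set.toFinite (D.part t)).toFinset.card - 1)

/-- The decomposition with a single part is connected and has finite width. -/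
theorem connectedTreeWidth_ne_top (hn : 2 ≤ n) : connectedTreeWidth (graph n) ≠ ⊤ := by
  let D : TreeDecomposition (graph n) PUnit :=
    { tree := ⊥
      isTree := SimpleGraph.IsTree.of_subsingleton
      part := fun _ => Set.univ
      vertex_mem := fun _ => ⟨⟨⟩, trivial⟩
      edge_mem := fun _ _ _ => ⟨⟨⟩, trivial, trivial⟩
      inter_subset := fun _ _ _ _ _ _ => Set.subset_univ _ }
  have hD : D.IsConnected := fun _ =>
    (SimpleGraph.induceUnivIso (graph n)).connected_iff.2 (graph_connected hn)
  refine ne_top_of_le_ne_top ?_ (sInf_le ⟨PUnit, D, hD, rfl⟩)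
  have h : D.width ≤ (Set.univ : Set (Vertex n)).encard :=
    iSup_le fun _ => tsub_le_self
  exact ne_top_of_le_ne_top (Set.encard_ne_top_iff.2 Set.finite_univ) h

end LowerBound


/-! ### Connected covers of brambles -/

section Brambles

variable {n : ℕ} {B : Set (Set (Vertex n))}

/-- If an element of a bramble lies in a region, then so does every element of the bramble that
avoids the boundary of the region. -/
theorem IsBramble.subset_region (hB : IsBramble (graph n) B) {U W R X : Set (Vertex n)}
    (hU : U ∈ B) (hUR : U ⊆ R) (hRX : ∀ v ∈ R, v ∉ X)
    (hR : ∀ v w, Step n v w → (v ∈ R → w ∈ R ∨ w ∈ X) ∧ (w ∈ R → v ∈ R ∨ v ∈ X))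
    (hW : W ∈ B) (hWX : ∀ v ∈ W, v ∉ X) : W ⊆ R := by
  obtain ⟨u, hu⟩ := (hB.1 U hU).nonempty
  refine Set.subset_union_right.trans
    ((hB.2 U hU W hW).subset_region ⟨u, Or.inl hu, hUR hu⟩ ?_ hR)
  rintro v (hv | hv)
  · exact hRX v (hUR hv)
  · exact hWX v hv

/-- The vertices strictly between the numbers `l` and `r` on the cycle `C`. -/
def arc (n l r : ℕ) : Set (Vertex n) :=
  {v | ∃ m : Fin (16 * n + 2), v = .c m ∧ l < m.val ∧ m.val < r}

/-- The bounds keep `a` and `b` out of the arc, so only edges of `C` leave it. The value `r = 16 * n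
+ 2` stands for `a`, as `cAt` reads its argument modulo the length of `C`. -/
theorem arc_boundary {l r : ℕ} (hr : r ≤ 16 * n + 2)
    (hb : 8 * n + 1 ≤ l ∨ r ≤ 8 * n + 1) (v w : Vertex n) (h : Step n v w) :
    (v ∈ arc n l r → w ∈ arc n l r ∨ w ∈ ({cAt n l, cAt n r} : Set (Vertex n))) ∧
      (w ∈ arc n l r → v ∈ arc n l r ∨ v ∈ ({cAt n l, cAt n r} : Set (Vertex n))) := by
  constructor
  · rintro ⟨m, rfl, h1, h2⟩
    cases h with
    | cycle _ m' h =>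
      rcases Nat.lt_or_ge (m.val + 1) r with h3 | h3
      · rw [Nat.mod_eq_of_lt (by omega)] at h
        exact Or.inl ⟨m', rfl, by omega, by omega⟩
      · right; right
        simp only [cAt, Set.mem_singleton_iff, Vertex.c.injEq, Fin.ext_iff]
        rw [h, show m.val + 1 = r by omega]
    | _ => omega
  · rintro ⟨m, rfl, h1, h2⟩
    cases h with
    | cycle m' _ h =>
      have hm' := m'.isLt
      rcases Nat.lt_or_ge (m'.val + 1) (16 * n + 2) with h3 | h3
      · rw [Nat.mod_eq_of_lt h3] at h
        rcases Nat.lt_or_ge l m'.val with h4 | h4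
        · exact Or.inl ⟨m', rfl, by omega, by omega⟩
        · right; left
          rw [cAt_of_lt (by omega)]
          simp only [Vertex.c.injEq, Fin.ext_iff]
          omega
      · rw [show m'.val + 1 = 16 * n + 2 by omega, Nat.mod_self] at h
        omega

theorem cAt_total : cAt n (16 * n + 2) = cAt n 0 := by simp [cAt]

theorem arc_disjoint {l r : ℕ} (hlr : l < r) (hr : r ≤ 16 * n + 2) :
    ∀ v ∈ arc n l r, v ∉ ({cAt n l, cAt n r} : Set (Vertex n)) := by
  rintro _ ⟨m, rfl, h1, h2⟩ (h | h)
  · rw [cAt_of_lt (by omega), Vertex.c.injEq, Fin.ext_iff] at h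
    exact h1.ne' h
  · rcases Nat.lt_or_ge r (16 * n + 2) with h3 | h3
    · rw [cAt_of_lt h3, Set.mem_singleton_iff, Vertex.c.injEq, Fin.ext_iff] at h
      exact h2.ne h
    · rw [show r = 16 * n + 2 by omega, cAt_total, cAt_of_lt (by omega),
        Set.mem_singleton_iff, Vertex.c.injEq, Fin.ext_iff] at h
      exact absurd h1 (by rw [h]; exact Nat.not_lt_zero l)

theorem isConnectedSet_path (hn : 0 < n) (i : Fin 3) :
    IsConnectedSet (graph n) (xAt n i '' Set.Icc 0 (2 * n - 1)) :=
  isConnectedSet_image_Icc (by omega) fun m _ hm => xAt_adj i (by omega)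

theorem cAt_a_adj_x (hn : 0 < n) : (graph n).Adj (cAt n 0) (xAt n 0 0) := by
  rw [cAt_of_lt (by omega), xAt_of_lt 0 (by omega)]
  exact (Step.aFirstX _ _ rfl rfl).adj

theorem cAt_b_adj_x (hn : 0 < n) :
    (graph n).Adj (cAt n (8 * n + 1)) (xAt n 0 (2 * n - 1)) := by
  rw [cAt_of_lt (by omega), xAt_of_lt 0 (by omega)]
  exact (Step.bLastX _ _ rfl (by simp; omega)).adj

theorem cAt_a_adj_y (hn : 0 < n) : (graph n).Adj (cAt n 0) (yAt n 0) := by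
  rw [cAt_of_lt (by omega), yAt_of_lt (by omega)]
  exact (Step.aFirstY _ _ rfl rfl).adj

theorem cAt_b_adj_y (hn : 0 < n) :
    (graph n).Adj (cAt n (8 * n + 1)) (yAt n (4 * n - 1)) := by
  rw [cAt_of_lt (by omega), yAt_of_lt (by omega)]
  exact (Step.bLastY _ _ rfl (by simp; omega)).adj

/-- If no small connected set covers a bramble, then no element of the bramble lies inside an arc
of `C` between `a` and `b`. -/
theorem IsBramble.not_subset_arc (hn : 4 ≤ n) (hB : IsBramble (graph n) B)
    (hcov : ∀ X, IsConnectedSet (graph n) X → X.encard ≤ (5 * n + 3 : ℕ) →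
      ∃ U ∈ B, ∀ v ∈ U, v ∉ X)
    {l r : ℕ} (hl : l = 0 ∨ l = 8 * n + 1) (hr : r = l + (8 * n + 1)) {U : Set (Vertex n)}
    (hU : U ∈ B) (hUA : U ⊆ arc n l r) : False := by
  obtain ⟨⟨jl, hjl, hjl'⟩, jr, hjr, hjr'⟩ :
      (∃ j < 2 * n, (graph n).Adj (cAt n l) (xAt n 0 j)) ∧
        ∃ j < 2 * n, (graph n).Adj (cAt n r) (xAt n 0 j) := by
    have ha := cAt_a_adj_x (n := n) (by omega)
    have hb := cAt_b_adj_x (n := n) (by omega)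
    rcases hl with rfl | rfl
    · rw [hr, zero_add]
      exact ⟨⟨_, by omega, ha⟩, _, by omega, hb⟩
    · rw [hr, show 8 * n + 1 + (8 * n + 1) = 16 * n + 2 by omega, cAt_total]
      exact ⟨⟨_, by omega, hb⟩, _, by omega, ha⟩
  have harc : ∀ a b, a ≤ b → IsConnectedSet (graph n) (cAt n '' Set.Icc a b) := fun a b hab =>
    isConnectedSet_image_Icc hab fun m _ _ => cAt_adj m
  -- `P₀` connects an initial piece of the arc to its other end: `2 * n + (3 * n + 1) + 1 = 5 * n +
  -- 2` vertices. An element missing them lies in the rest of the arc, which with its ends has `5 *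
  -- n + 2` vertices and is the next set tried.
  obtain ⟨W, hW, hWX⟩ := hcov
    ((xAt n 0 '' Set.Icc 0 (2 * n - 1) ∪ cAt n '' Set.Icc l (l + 3 * n)) ∪ {cAt n r})
    (((isConnectedSet_path (by omega) 0).union (harc _ _ (by omega))
      ⟨jl, ⟨by omega, by omega⟩, rfl⟩ ⟨l, ⟨le_rfl, by omega⟩, rfl⟩ (Or.inr hjl'.symm)).union
      (isConnectedSet_singleton _) (Or.inl ⟨jr, ⟨by omega, by omega⟩, rfl⟩) rfl
      (Or.inr hjr'.symm))
    (encard_union_le_of_le (k := 5 * n + 1) (l := 1)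
      (encard_union_le_of_le (k := 2 * n) (l := 3 * n + 1) (encard_image_Icc_le _ (by omega))
        (encard_image_Icc_le _ (by omega)) (by omega)) (by simp) (by omega))
  have hWA : W ⊆ arc n l r := by
    refine hB.subset_region hU hUA (arc_disjoint (by omega) (by omega))
      (arc_boundary (by omega) (by omega)) hW ?_
    rintro v hv (rfl | rfl)
    · exact hWX _ hv (Or.inl (Or.inr ⟨l, ⟨le_rfl, by omega⟩, rfl⟩))
    · exact hWX _ hv (Or.inr rfl)
  have hWA' : W ⊆ arc n (l + 3 * n) r := by
    intro v hv
    obtain ⟨m, rfl, h1, h2⟩ := hWA hv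
    refine ⟨m, rfl, ?_, h2⟩
    by_contra h
    exact hWX _ hv (Or.inl (Or.inr ⟨m.val, ⟨by omega, by omega⟩, cAt_val m⟩))
  obtain ⟨W', hW', hWX'⟩ := hcov (cAt n '' Set.Icc (l + 3 * n) r) (harc _ _ (by omega))
    (encard_image_Icc_le _ (by omega))
  have hsub : W' ⊆ arc n (l + 3 * n) r := by
    refine hB.subset_region hW hWA' (arc_disjoint (by omega) (by omega))
      (arc_boundary (by omega) (by omega)) hW' ?_
    rintro v hv (rfl | rfl)
    · exact hWX' _ hv ⟨_, ⟨le_rfl, by omega⟩, rfl⟩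
    · exact hWX' _ hv ⟨_, ⟨by omega, le_rfl⟩, rfl⟩
  obtain ⟨v, hv⟩ := (hB.1 W' hW').nonempty
  obtain ⟨m, rfl, h1, h2⟩ := hsub hv
  exact hWX' _ hv ⟨m.val, ⟨by omega, by omega⟩, cAt_val m⟩

/-! ### Connected covers built on `Q`, and the paths `P_i` -/

/-- The set consisting of `Q`, `a` and `b`. -/
def spine (n : ℕ) : Set (Vertex n) :=
  (yAt n '' Set.Icc 0 (4 * n - 1) ∪ {cAt n 0}) ∪ {cAt n (8 * n + 1)}

theorem isConnectedSet_spine (hn : 0 < n) : IsConnectedSet (graph n) (spine n) := by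
  have hQ : IsConnectedSet (graph n) (yAt n '' Set.Icc 0 (4 * n - 1)) :=
    isConnectedSet_image_Icc (by omega) fun m _ hm => yAt_adj (by omega)
  have hQa := hQ.union (isConnectedSet_singleton (cAt n 0)) (v := yAt n 0) (w := cAt n 0)
    ⟨0, ⟨le_rfl, by omega⟩, rfl⟩ rfl (Or.inr (cAt_a_adj_y hn).symm)
  exact hQa.union (isConnectedSet_singleton (cAt n (8 * n + 1))) (v := yAt n (4 * n - 1))
    (w := cAt n (8 * n + 1)) (Or.inl ⟨4 * n - 1, ⟨by omega, le_rfl⟩, rfl⟩) rfl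
    (Or.inr (cAt_b_adj_y hn).symm)

theorem encard_spine_le (hn : 0 < n) : (spine n).encard ≤ (4 * n + 2 : ℕ) :=
  encard_union_le_of_le (k := 4 * n + 1) (l := 1)
    (encard_union_le_of_le (k := 4 * n) (l := 1) (encard_image_Icc_le _ (by omega)) (by simp)
      (by omega)) (by simp) (by omega)

theorem y_mem_spine (k : Fin (4 * n)) : .y k ∈ spine n :=
  Or.inl (Or.inl ⟨k.val, ⟨by omega, by have := k.isLt; omega⟩, yAt_val k⟩)

theorem c_mem_spine {m : Fin (16 * n + 2)} (h : m.val = 0 ∨ m.val = 8 * n + 1) :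
    .c m ∈ spine n := by
  rcases h with h | h
  · exact Or.inl (Or.inr (by rw [Set.mem_singleton_iff, ← h, cAt_val]))
  · exact Or.inr (by rw [Set.mem_singleton_iff, ← h, cAt_val])

/-- The vertices `x i j` with `l ≤ j < r` and the inner vertices of the links at them. -/
def segment (n : ℕ) (i : Fin 3) (l r : ℕ) : Set (Vertex n) :=
  {v | ∃ j : Fin (2 * n), (v = .x i j ∨ ∃ k s, v = .link i j k s) ∧ l ≤ j.val ∧ j.val < r}

/-- The neighbourhood of a segment. -/
def segmentBoundary (n : ℕ) (i : Fin 3) (l r : ℕ) : Set (Vertex n) :=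
  spine n ∪ {v | ∃ j : Fin (2 * n), v = .x i j ∧ (j.val + 1 = l ∨ j.val = r)}

/-- Links end on `Q` and the ends of `P₀` attach to `a` and `b`, so every exit other than along
`P_i` is in the spine. -/
theorem segment_boundary (i : Fin 3) (l r : ℕ) (v w : Vertex n) (h : Step n v w) :
    (v ∈ segment n i l r → w ∈ segment n i l r ∨ w ∈ segmentBoundary n i l r) ∧
      (w ∈ segment n i l r → v ∈ segment n i l r ∨ v ∈ segmentBoundary n i l r) := by
  constructor
  · rintro ⟨j, rfl | ⟨k, s, rfl⟩, h1, h2⟩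
    · cases h with
      | path _ _ j' h =>
        rcases Nat.lt_or_ge j'.val r with h3 | h3
        · exact Or.inl ⟨j', Or.inl rfl, by omega, h3⟩
        · exact Or.inr (Or.inr ⟨j', rfl, by omega⟩)
      | linkFirst => exact Or.inl ⟨j, Or.inr ⟨_, _, rfl⟩, h1, h2⟩
    · cases h with
      | linkInner => exact Or.inl ⟨j, Or.inr ⟨_, _, rfl⟩, h1, h2⟩
      | linkLast => exact Or.inr (Or.inl (y_mem_spine _))
  · rintro ⟨j, rfl | ⟨k, s, rfl⟩, h1, h2⟩
    · cases h with
      | path _ j' _ h =>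
        rcases Nat.lt_or_ge j'.val l with h3 | h3
        · exact Or.inr (Or.inr ⟨j', rfl, by omega⟩)
        · exact Or.inl ⟨j', Or.inl rfl, by omega, by omega⟩
      | aFirstX _ _ hm => exact Or.inr (Or.inl (c_mem_spine (Or.inl hm)))
      | bLastX _ _ hm => exact Or.inr (Or.inl (c_mem_spine (Or.inr hm)))
    · cases h with
      | linkFirst => exact Or.inl ⟨j, Or.inl rfl, h1, h2⟩
      | linkInner => exact Or.inl ⟨j, Or.inr ⟨_, _, rfl⟩, h1, h2⟩

theorem x_notMem_spine (i : Fin 3) (j : Fin (2 * n)) : .x i j ∉ spine n := by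
  rintro ((⟨k, hk, h⟩ | h) | h)
  · unfold yAt at h
    split_ifs at h
  · cases h
  · cases h

theorem link_notMem_spine (i : Fin 3) (j : Fin (2 * n)) (k : Fin (4 * n))
    (s : Fin (linkLength n j k - 1)) : .link i j k s ∉ spine n := by
  rintro ((⟨k, hk, h⟩ | h) | h)
  · unfold yAt at h
    split_ifs at h
  · cases h
  · cases h

theorem segment_disjoint (i : Fin 3) (l r : ℕ) :
    ∀ v ∈ segment n i l r, v ∉ segmentBoundary n i l r := by
  rintro v ⟨j, rfl | ⟨k, s, rfl⟩, h1, h2⟩ (h | ⟨j', h, h3⟩)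
  · exact x_notMem_spine i j h
  · cases h
    omega
  · exact link_notMem_spine i j k s h
  · cases h

/-- The set `spine n` with the short link at `x i j`. -/
def hangingSpine (n : ℕ) (i : Fin 3) (j : Fin (2 * n)) : Set (Vertex n) :=
  -- The end of the short link on `Q` is already in the spine, so only `n` vertices are added.
  spine n ∪ linkAt n i j ⟨n + j.val, by omega⟩ '' Set.Icc 0 (n - 1)

theorem isConnectedSet_hangingSpine (hn : 2 ≤ n) (i : Fin 3) (j : Fin (2 * n)) :
    IsConnectedSet (graph n) (hangingSpine n i j) := by
  have hlen : linkLength n j ⟨n + j.val, by omega⟩ = n := by simp [linkLength]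
  have hadj := linkAt_adj hn i j ⟨n + j.val, by omega⟩ (s := n - 1) (by omega)
  have hend := linkAt_linkLength i j ⟨n + j.val, by omega⟩
  rw [hlen] at hend
  rw [show n - 1 + 1 = n by omega, hend] at hadj
  exact (isConnectedSet_spine (by omega)).union
    (isConnectedSet_image_Icc (by omega) fun m _ hm => linkAt_adj hn i j _ (by omega))
    (y_mem_spine _) ⟨n - 1, ⟨by omega, le_rfl⟩, rfl⟩ (Or.inr hadj.symm)

theorem encard_hangingSpine_le (hn : 0 < n) (i : Fin 3) (j : Fin (2 * n)) :
    (hangingSpine n i j).encard ≤ (5 * n + 2 : ℕ) :=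
  encard_union_le_of_le (encard_spine_le hn) (encard_image_Icc_le (k := n) _ (by omega)) (by omega)

theorem x_mem_hangingSpine (i : Fin 3) (j : Fin (2 * n)) : .x i j ∈ hangingSpine n i j :=
  Or.inr ⟨0, ⟨le_rfl, by omega⟩, rfl⟩

/-- If no small connected set covers a bramble, then no element of the bramble lies inside a
link. -/
theorem IsBramble.not_subset_linkInterior (hn : 4 ≤ n) (hB : IsBramble (graph n) B)
    (hcov : ∀ X, IsConnectedSet (graph n) X → X.encard ≤ (5 * n + 3 : ℕ) →
      ∃ U ∈ B, ∀ v ∈ U, v ∉ X)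
    {i : Fin 3} {j : Fin (2 * n)} {k : Fin (4 * n)} {U : Set (Vertex n)} (hU : U ∈ B)
    (hUI : U ⊆ linkInterior i j k) : False := by
  have hlen := linkLength_le j k
  -- A whole link with its ends has at most `5 * n + 1` vertices.
  obtain ⟨W, hW, hWX⟩ := hcov (linkAt n i j k '' Set.Icc 0 (linkLength n j k))
    (isConnectedSet_image_Icc (by omega) fun m _ hm => linkAt_adj (by omega) i j k hm)
    (encard_image_Icc_le _ (by omega))
  have hsub : W ⊆ linkInterior i j k := by
    refine hB.subset_region hU hUI (X := {.x i j, .y k}) ?_ (linkInterior_boundary i j k) hW ?_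
    · rintro v ⟨s, rfl⟩ (h | h) <;> cases h
    · rintro v hv (rfl | rfl)
      · exact hWX _ hv ⟨0, ⟨le_rfl, by omega⟩, rfl⟩
      · exact hWX _ hv ⟨linkLength n j k, ⟨by omega, le_rfl⟩, linkAt_linkLength i j k⟩
  obtain ⟨v, hv⟩ := (hB.1 W hW).nonempty
  obtain ⟨s, rfl⟩ := hsub hv
  have hs := s.isLt
  exact hWX _ hv ⟨s.val + 1, ⟨by omega, by omega⟩, linkAt_succ i j k s.isLt⟩

/-- If no small connected set covers a bramble, then no element of the bramble consists of
vertices of a path `P_i` and its links. -/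
theorem IsBramble.not_subset_segment (hn : 4 ≤ n) (hB : IsBramble (graph n) B)
    (hcov : ∀ X, IsConnectedSet (graph n) X → X.encard ≤ (5 * n + 3 : ℕ) →
      ∃ U ∈ B, ∀ v ∈ U, v ∉ X)
    {i : Fin 3} {U₀ : Set (Vertex n)} (hU₀ : U₀ ∈ B) (hUS : U₀ ⊆ segment n i 0 (2 * n)) :
    False := by
  have hside : ∀ j : Fin (2 * n), ∃ U ∈ B, (∀ v ∈ U, v ∉ hangingSpine n i j) ∧
      (U ⊆ segment n i 0 j.val ∨ U ⊆ segment n i (j.val + 1) (2 * n)) := by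
    intro j
    obtain ⟨U, hU, hUX⟩ := hcov (hangingSpine n i j) (isConnectedSet_hangingSpine (by omega) i j)
      ((encard_hangingSpine_le (by omega) i j).trans (by exact_mod_cast (by omega)))
    refine ⟨U, hU, hUX, ?_⟩
    have hUsp : ∀ v ∈ U, v ∉ spine n := fun v hv h => hUX v hv (Or.inl h)
    have hUxj : ∀ v ∈ U, v ≠ .x i j := fun v hv h => hUX v hv (h ▸ x_mem_hangingSpine i j)
    have hUP : U ⊆ segment n i 0 (2 * n) := by
      refine hB.subset_region hU₀ hUS (segment_disjoint i _ _) (segment_boundary i _ _) hU ?_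
      rintro v hv (h | ⟨j', rfl, h⟩)
      · exact hUsp v hv h
      · have := j'.isLt
        omega
    obtain ⟨v, hv⟩ := (hB.1 U hU).nonempty
    obtain ⟨j', hj', h1, h2⟩ := hUP hv
    rcases lt_trichotomy j'.val j.val with h3 | h3 | h3
    · left
      refine (hB.1 U hU).subset_region ⟨v, hv, j', hj', h1, h3⟩ ?_ (segment_boundary i _ _)
      rintro w hw (h | ⟨j₁, rfl, h⟩)
      · exact hUsp w hw h
      · exact hUxj _ hw (by rw [show j₁ = j from Fin.ext (by omega)])
    · exfalso
      obtain rfl : j' = j := Fin.ext h3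
      rcases hj' with rfl | ⟨k, s, rfl⟩
      · exact hUxj _ hv rfl
      · refine hB.not_subset_linkInterior hn hcov hU (i := i) (j := j') (k := k)
          ((hB.1 U hU).subset_region (R := linkInterior i j' k) ⟨_, hv, s, rfl⟩ ?_ (linkInterior_boundary i j' k))
        rintro w hw (rfl | rfl)
        · exact hUxj _ hw rfl
        · exact hUsp _ hw (y_mem_spine k)
    · right
      refine (hB.1 U hU).subset_region ⟨v, hv, j', hj', h3, h2⟩ ?_ (segment_boundary i _ _)
      rintro w hw (h | ⟨j₁, rfl, h⟩)
      · exact hUsp w hw h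
      · refine hUxj _ hw ?_
        have := j₁.isLt
        rw [show j₁ = j from Fin.ext (by omega)]
  -- Nothing lies to the left of the first vertex, and the side never changes; at the last vertex
  -- nothing is left on the right.
  have hright : ∀ m (hm : m < 2 * n), ∃ U ∈ B, (∀ v ∈ U, v ∉ hangingSpine n i ⟨m, hm⟩) ∧
      U ⊆ segment n i (m + 1) (2 * n) := by
    intro m
    induction m with
    | zero =>
      intro hm
      obtain ⟨U, hU, hUX, h | h⟩ := hside ⟨0, hm⟩
      · obtain ⟨v, hv⟩ := (hB.1 U hU).nonempty
        obtain ⟨j', -, h1, h2⟩ := h hv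
        exact absurd h2 (by simp)
      · exact ⟨U, hU, hUX, h⟩
    | succ m ih =>
      intro hm
      obtain ⟨U, hU, hUX, h | h⟩ := hside ⟨m + 1, hm⟩
      · exfalso
        obtain ⟨U', hU', hUX', h'⟩ := ih (by omega)
        have hadj : (graph n).Adj (.x i ⟨m, by omega⟩) (.x i ⟨m + 1, hm⟩) :=
          (Step.path i _ _ rfl).adj
        -- This set attains the bound `5 * n + 3`. It contains both `x i m` and `x i (m + 1)`, so an
        -- element missing it would lie both right of `x i m` and left of `x i (m + 1)`.
        obtain ⟨W, hW, hWX⟩ := hcov (hangingSpine n i ⟨m, by omega⟩ ∪ {.x i ⟨m + 1, hm⟩})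
          ((isConnectedSet_hangingSpine (by omega) i _).union (isConnectedSet_singleton _)
            (x_mem_hangingSpine i _) rfl (Or.inr hadj))
          (encard_union_le_of_le (l := 1) (encard_hangingSpine_le (by omega) i _) (by simp)
            (by omega))
        have hWr : W ⊆ segment n i (m + 1) (2 * n) := by
          refine hB.subset_region hU' h' (segment_disjoint i _ _) (segment_boundary i _ _) hW ?_
          rintro w hw (h | ⟨j₁, rfl, h⟩)
          · exact hWX w hw (Or.inl (Or.inl h))
          · have := j₁.isLt
            rw [show j₁ = ⟨m, by omega⟩ from Fin.ext (by simp; omega)] at hw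
            exact hWX _ hw (Or.inl (x_mem_hangingSpine i _))
        have hWl : W ⊆ segment n i 0 (m + 1) := by
          refine hB.subset_region hU h (segment_disjoint i _ _) (segment_boundary i _ _) hW ?_
          rintro w hw (h | ⟨j₁, rfl, h⟩)
          · exact hWX w hw (Or.inl (Or.inl h))
          · rw [show j₁ = ⟨m + 1, hm⟩ from Fin.ext (by simp at h ⊢; omega)] at hw
            exact hWX _ hw (Or.inr rfl)
        obtain ⟨v, hv⟩ := (hB.1 W hW).nonempty
        obtain ⟨j₁, h1, h2, h3⟩ := hWr hv
        obtain ⟨j₂, h4, h5, h6⟩ := hWl hv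
        have : j₁ = j₂ := by
          rcases h1 with rfl | ⟨k, s, rfl⟩ <;> rcases h4 with h4 | ⟨k', s', h4⟩ <;> cases h4 <;> rfl
        subst this
        omega
      · exact ⟨U, hU, hUX, h⟩
  obtain ⟨U, hU, -, h⟩ := hright (2 * n - 1) (by omega)
  obtain ⟨v, hv⟩ := (hB.1 U hU).nonempty
  obtain ⟨j', -, h1, h2⟩ := h hv
  omega

theorem IsBramble.connectedOrder_le (hn : 4 ≤ n) (hB : IsBramble (graph n) B) :
    connectedOrder (graph n) B ≤ (5 * n + 3 : ℕ) := by
  by_contra hlarge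
  have hcov : ∀ X, IsConnectedSet (graph n) X → X.encard ≤ (5 * n + 3 : ℕ) →
      ∃ U ∈ B, ∀ v ∈ U, v ∉ X := by
    intro X hX hcard
    by_contra! h
    have hXB : IsCover B X := by
      intro U hU
      obtain ⟨v, hv, hvX⟩ := h U hU
      exact ⟨v, hvX, hv⟩
    have hle : connectedOrder (graph n) B ≤ X.encard := sInf_le ⟨X, hX, hXB, rfl⟩
    exact hlarge (hle.trans hcard)
  -- Without the spine the graph falls into the two arcs of `C` and the three `P_i` with their
  -- links; `U` lies in one of these.
  obtain ⟨U, hU, hUX⟩ := hcov (spine n) (isConnectedSet_spine (by omega))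
    ((encard_spine_le (by omega)).trans (by exact_mod_cast (by omega)))
  have hUc := hB.1 U hU
  obtain ⟨v, hv⟩ := hUc.nonempty
  have hseg : ∀ i, v ∈ segment n i 0 (2 * n) → False := by
    intro i hi
    refine hB.not_subset_segment hn hcov hU (i := i)
      (hUc.subset_region (R := segment n i 0 (2 * n)) ⟨v, hv, hi⟩ ?_ (segment_boundary i _ _))
    rintro w hw (h | ⟨j, rfl, h⟩)
    · exact hUX w hw h
    · have := j.isLt
      omega
  have harc : ∀ l r, l = 0 ∨ l = 8 * n + 1 → r = l + (8 * n + 1) → v ∈ arc n l r → False := by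
    intro l r hl hr hvA
    refine hB.not_subset_arc hn hcov hl hr hU
      (hUc.subset_region (R := arc n l r) ⟨v, hv, hvA⟩ ?_ (arc_boundary (by omega) (by omega)))
    have ha : cAt n 0 ∈ spine n := Or.inl (Or.inr rfl)
    have hb : cAt n (8 * n + 1) ∈ spine n := Or.inr rfl
    rcases hl with rfl | rfl
    · rw [hr, zero_add]
      rintro w hw (rfl | rfl)
      exacts [hUX _ hw ha, hUX _ hw hb]
    · rw [hr, show 8 * n + 1 + (8 * n + 1) = 16 * n + 2 by omega, cAt_total]
      rintro w hw (rfl | rfl)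
      exacts [hUX _ hw hb, hUX _ hw ha]
  cases v with
  | x i j => exact hseg i ⟨j, Or.inl rfl, Nat.zero_le _, j.isLt⟩
  | y k => exact hUX _ hv (y_mem_spine k)
  | link i j k s => exact hseg i ⟨j, Or.inr ⟨k, s, rfl⟩, Nat.zero_le _, j.isLt⟩
  | c m =>
    by_cases h0 : m.val = 0 ∨ m.val = 8 * n + 1
    · exact hUX _ hv (c_mem_spine h0)
    · have := m.isLt
      rcases Nat.lt_or_ge m.val (8 * n + 1) with h | h
      · exact harc 0 _ (Or.inl rfl) rfl ⟨m, rfl, by omega, by omega⟩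
      · exact harc (8 * n + 1) _ (Or.inr rfl) rfl ⟨m, rfl, by omega, by omega⟩

end Brambles

theorem not_dualityConjecture : ¬ DualityConjecture := by
  intro h
  have hdual := h (Vertex 4) (graph 4) (graph_connected (by omega))
  -- For `n = 4` the bounds are `5 * 4 + 3 = 23` and `6 * 4 + 1 = 25`.
  have hcbn : connectedBrambleNumber (graph 4) ≤ (23 : ℕ) := by
    refine sSup_le ?_
    rintro m ⟨B, hB, rfl⟩
    exact hB.connectedOrder_le le_rfl
  have hctw : ((24 : ℕ) : ℕ∞) + 1 ≤ connectedTreeWidth (graph 4) + 1 :=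
    add_le_add (le_connectedTreeWidth (n := 4) (by omega)) le_rfl
  have := hctw.trans (hdual ▸ hcbn)
  exact absurd (by exact_mod_cast this : 24 + 1 ≤ 23) (by omega)

end CtwDuality

theorem mainTheorem5 :
    (∀ n : ℕ, 4 ≤ n →
      Finite (CtwDuality.Vertex n) ∧
      (CtwDuality.graph n).Connected ∧
      ((6 * n : ℕ) : ℕ∞) ≤ CtwDuality.connectedTreeWidth (CtwDuality.graph n) ∧
      CtwDuality.connectedTreeWidth (CtwDuality.graph n) ≠ ⊤ ∧
      ∀ B : Set (Set (CtwDuality.Vertex n)), CtwDuality.IsBramble (CtwDuality.graph n) B →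
        CtwDuality.connectedOrder (CtwDuality.graph n) B ≤ ((5 * n + 3 : ℕ) : ℕ∞)) ∧
    ¬ CtwDuality.DualityConjecture := by
  refine ⟨fun n hn => ⟨inferInstance, CtwDuality.graph_connected (by omega),
    CtwDuality.le_connectedTreeWidth (by omega), CtwDuality.connectedTreeWidth_ne_top (by omega),
    fun B hB => hB.connectedOrder_le hn⟩, CtwDuality.not_dualityConjecture⟩
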